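/- Let $\mathbb K$ be a field of characteristic zero. **Partitions.** Let $\mathrm{NCP}$ be the set of nonempty noncrossing partitions (one standard representative on $[n]=\{1,\dots,n\}$, $n\ge 1$, for each isomorphism class) and $\mathrm{NCP}_0=\mathrm{NCP}\sqcup\{\emptyset\}$. Restrictions $P_{|X}$ are always standardized. Write $P\le Q$ if $P,Q$ are noncrossing partitions of the same $[n]$ and $Q$ is coarser than or equal to $P$. For blocks of $P$, write $\pi\to\rho$ if $[\min\pi,\max\pi]\cap\rho\ne\emptyset$. A *cut* $(L,U)$ of $P$ is a splitting of the set of blocks such that $\sigma\to\pi\in L$ implies $\sigma\in L$. If $x_1<\dots<x_k$ are the elements of the blocks in $L$, let $U_0,\dots,U_k$ be the restrictions of $P$ to the gaps $\{y<x_1\},\{x_1<y<x_2\},\dots,\{y>x_k\}$ (for $k=0$ the single gap is $[n]$). **Algebras.** $B^{NC}_{gap}$ is the free associative algebra on $\mathrm{NCP}_0$, with $\Delta_0(P)=\sum_{(L,U)\in\mathrm{cut}(P)}L\otimes U_0\cdots U_k$ extended multiplicatively and counit $0$ on $\mathrm{NCP}$ and $1$ on $\emptyset$. $H=H^{NC}_{gap}$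 is the free associative algebra on $\mathrm{NCP}$; let $q:B^{NC}_{gap}\to H$ be the algebra map with $q(\emptyset)=\mathbf 1$ and $q(P)=P$ for $P\in\mathrm{NCP}$. $H$ has the multiplicative coproduct $\Delta(P)=\sum_{(L,U)\in\mathrm{cut}(P)}L\otimes \overline U$ for $P\in\mathrm{NCP}$, where $\overline U=q(U_0\cdots U_k)$ and an empty $L$ is read as $\mathbf 1$, and counit $\varepsilon(P)=0$ for $P\in \mathrm{NCP}$; $H_+=\ker\varepsilon$. A cut $(L,U)$ of a monomial $P=P_1\cdots P_m$ is a sequence of cuts $(L_i,U_i)$ of the $P_i$, with $L$ the monomial $L_1\cdots L_m$ and $\overline U=\overline{U_1}\cdots\overline{U_m}$. For $m\ge1$ put $$\Delta_\prec(P)=\sum_{(L,U)\in\mathrm{cut}(P),\ 1\in L}L\otimes\overline U,\qquad \Delta_\succ(P)=\sum_{(L,U)\in\mathrm{cut}(P),\ 1\in U}L\otimes\overline U,$$ where $1$ is the first element of $P_1$; this defines linear maps on $H_+$. $B=B^{NC}_{bl}$ is the free commutative algebra on $\mathrm{NCP}$, with multiplicative coproduct $\delta(P)=\sum_{P\le Q}Q\otimes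 P/Q$, where $P/Q=\prod_{\tau}P_{|\tau}$ over the blocks $\tau$ of $Q$, and counit $1$ on one-block partitions and $0$ on the other elements of $\mathrm{NCP}$. Finally, $\rho:B^{NC}_{gap}\to B^{NC}_{gap}\otimes B$ is the algebra map $\rho(P)=\sum_{P\le Q}Q\otimes P/Q$ (so $\rho(\emptyset)=\emptyset\otimes 1$). **Theorem.** 1. The map $q$ is surjective, its kernel is the two-sided ideal generated by $\emptyset-\mathbf 1$, and $(q\otimes q)\Delta_0=\Delta q$, $\varepsilon q=\varepsilon_{B^{NC}_{gap}}$. The coaction descends along $q$ to the algebra map $\rho:H\to H\otimes B$, $\rho(P)=\sum_{P\le Q}Q\otimes P/Q$ for $P\in \mathrm{NCP}$: $\rho\circ q=(q\otimes\mathrm{Id})\circ\rho$. 2. $B$ is a commutative bialgebra, and $H$ is an unshuffle (codendriform) Hopf algebra: it is a bialgebra with antipode, and on $H_+$ one has $\Delta=\Delta_\prec+\Delta_\succ$, $$(\Delta_\prec\otimes\mathrm{Id})\Delta_\prec=(\mathrm{Id}\otimes\Delta)\Delta_\prec,\quad(\Delta_\succ\otimes\mathrm{Id})\Delta_\prec=(\mathrm{Id}\otimes\Delta_\prec)\Delta_\succ,\quad(\Delta\otimes\mathrm{Id})\Delta_\succ=(\mathrm{Id}\otimes\Delta_\succ)\Delta_\succ,$$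 $\Delta_\prec(x)-x\otimes\mathbf 1\in H_+\otimes H_+$, $\Delta_\succ(x)-\mathbf 1\otimes x\in H_+\otimes H_+$, $\Delta_\prec(xy)=\Delta_\prec(x)\Delta(y)$ and $\Delta_\succ(xy)=\Delta_\succ(x)\Delta(y)$ for all $x,y\in H_+$. 3. $\rho$ makes $H$ an unshuffle Hopf algebra in the monoidal category of right $B$-comodules: $(H,\rho)$ is a coassociative counital right $B$-comodule, the unit, product, counit, coproduct and antipode of $H$ are comodule morphisms, $\rho(H_+)\subseteq H_+\otimes B$, and for all $x\in H_+$ $$(\Delta_\prec\otimes\mathrm{Id})\rho(x)=(\mathrm{Id}\otimes\mathrm{Id}\otimes m_B)(\mathrm{Id}\otimes\tau\otimes\mathrm{Id})(\rho\otimes\rho)\Delta_\prec(x),$$ $$(\Delta_\succ\otimes\mathrm{Id})\rho(x)=(\mathrm{Id}\otimes\mathrm{Id}\otimes m_B)(\mathrm{Id}\otimes\tau\otimes\mathrm{Id})(\rho\otimes\rho)\Delta_\succ(x),$$ where $\tau:B\otimes H\to H\otimes B$ is the swap and $m_B$ the product of $B$. -/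

import Mathlib

open scoped TensorProduct

noncomputable section

/-! ### General notions: coalgebras, comodules, unshuffle Hopf algebras

The structure maps are given explicitly, so that the predicates below state that given, concrete maps
satisfy the axioms. -/

section General

variable {K : Type*} [Field K]

/-- `(C, Δ, ε)` is a coassociative counital coalgebra (the axioms of Mathlib's class `Coalgebra`). -/
structure IsCoalg {C : Type*} [AddCommGroup C] [Module K C]
    (comul : C →ₗ[K] C ⊗[K] C) (counit : C →ₗ[K] K) : Prop where
  coassoc : (TensorProduct.assoc K C C C).toLinearMap ∘ₗ comul.rTensor C ∘ₗ comul
    = comul.lTensor C ∘ₗ comul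
  counit_left : counit.rTensor C ∘ₗ comul = TensorProduct.mk K K C 1
  counit_right : counit.lTensor C ∘ₗ comul = (TensorProduct.mk K C K).flip 1

/-- `(A, ·, 1, Δ, ε)` is a bialgebra: a coalgebra whose structure maps are algebra morphisms. -/
structure IsBialg {A : Type*} [Ring A] [Algebra K A]
    (comul : A →ₗ[K] A ⊗[K] A) (counit : A →ₗ[K] K) : Prop extends IsCoalg comul counit where
  comul_one : comul 1 = 1
  comul_mul : ∀ x y, comul (x * y) = comul x * comul y
  counit_one : counit 1 = 1
  counit_mul : ∀ x y, counit (x * y) = counit x * counit y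

/-- `S` is an antipode of the bialgebra `(A, Δ, ε)`. -/
structure IsAntipode {A : Type*} [Ring A] [Algebra K A]
    (comul : A →ₗ[K] A ⊗[K] A) (counit : A →ₗ[K] K) (S : A →ₗ[K] A) : Prop where
  left : LinearMap.mul' K A ∘ₗ S.rTensor A ∘ₗ comul = Algebra.linearMap K A ∘ₗ counit
  right : LinearMap.mul' K A ∘ₗ S.lTensor A ∘ₗ comul = Algebra.linearMap K A ∘ₗ counit

/-- `ρ : M → M ⊗ B` is a right coaction of the coalgebra `(B, δ, ε_B)`. -/
structure IsRightComodule {B M : Type*} [AddCommGroup B] [Module K B]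
    [AddCommGroup M] [Module K M] (δ : B →ₗ[K] B ⊗[K] B) (εB : B →ₗ[K] K)
    (ρ : M →ₗ[K] M ⊗[K] B) : Prop where
  coassoc : (TensorProduct.assoc K M B B).toLinearMap ∘ₗ ρ.rTensor B ∘ₗ ρ = δ.lTensor M ∘ₗ ρ
  counit : εB.lTensor M ∘ₗ ρ = (TensorProduct.mk K M K).flip 1

section Comodules

variable {B M N : Type*} [CommRing B] [Algebra K B]
  [AddCommGroup M] [Module K M] [AddCommGroup N] [Module K N]

/-- `f` is a morphism of right `B`-comodules. -/
def IsComoduleHom (ρM : M →ₗ[K] M ⊗[K] B) (ρN : N →ₗ[K] N ⊗[K] B) (f : M →ₗ[K] N) : Prop :=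
  f.rTensor B ∘ₗ ρM = ρN ∘ₗ f

/-- The coaction on the tensor product of two comodules, for the monoidal structure of comodules over
the commutative bialgebra `B`: `(Id ⊗ Id ⊗ m_B) ∘ (Id ⊗ τ ⊗ Id) ∘ (ρM ⊗ ρN)`. -/
def tensorCoaction (ρM : M →ₗ[K] M ⊗[K] B) (ρN : N →ₗ[K] N ⊗[K] B) :
    M ⊗[K] N →ₗ[K] (M ⊗[K] N) ⊗[K] B :=
  (LinearMap.mul' K B).lTensor (M ⊗[K] N)
    ∘ₗ (TensorProduct.tensorTensorTensorComm K M B N B).toLinearMap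
    ∘ₗ TensorProduct.map ρM ρN

variable (K B) in
/-- The coaction `1 ↦ 1 ⊗ 1` on the monoidal unit `K`. -/
def unitCoaction : K →ₗ[K] K ⊗[K] B := (TensorProduct.mk K K B).flip 1

end Comodules

/-- An unshuffle (codendriform) Hopf algebra, with augmentation ideal `A₊ = ker ε`.
The half-coproducts are maps on `A₊`; they are represented by maps on `A` of which only the
restriction to `A₊` is constrained, and by `prec_lead`, `succ_lead` they have the form
`Δ_≺(x) = x ⊗ 1 + x'_≺ ⊗ x''_≺` and `Δ_≻(x) = 1 ⊗ x + x'_≻ ⊗ x''_≻` with reduced parts in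
`A₊ ⊗ A₊`, so that all the composites below only use their values on `A₊`.
Expanding the products in `prec_mul` and `succ_mul` with these forms and
`Δ(y) = y ⊗ 1 + 1 ⊗ y + y' ⊗ y''` gives the compatibility in Sweedler notation. -/
structure IsUnshuffleHopf {A : Type*} [Ring A] [Algebra K A]
    (comul : A →ₗ[K] A ⊗[K] A) (counit : A →ₗ[K] K) (prec succ : A →ₗ[K] A ⊗[K] A) : Prop
    extends IsBialg comul counit where
  antipode : ∃ S : A →ₗ[K] A, IsAntipode comul counit S
  split : ∀ x ∈ LinearMap.ker counit, comul x = prec x + succ x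
  prec_lead : ∀ x ∈ LinearMap.ker counit,
    prec x - x ⊗ₜ[K] 1 ∈ LinearMap.range
      (TensorProduct.map (LinearMap.ker counit).subtype (LinearMap.ker counit).subtype)
  succ_lead : ∀ x ∈ LinearMap.ker counit,
    succ x - 1 ⊗ₜ[K] x ∈ LinearMap.range
      (TensorProduct.map (LinearMap.ker counit).subtype (LinearMap.ker counit).subtype)
  prec_prec : ∀ x ∈ LinearMap.ker counit,
    TensorProduct.assoc K A A A (prec.rTensor A (prec x)) = comul.lTensor A (prec x)
  succ_prec : ∀ x ∈ LinearMap.ker counit,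
    TensorProduct.assoc K A A A (succ.rTensor A (prec x)) = prec.lTensor A (succ x)
  comul_succ : ∀ x ∈ LinearMap.ker counit,
    TensorProduct.assoc K A A A (comul.rTensor A (succ x)) = succ.lTensor A (succ x)
  prec_mul : ∀ x ∈ LinearMap.ker counit, ∀ y ∈ LinearMap.ker counit,
    prec (x * y) = prec x * comul y
  succ_mul : ∀ x ∈ LinearMap.ker counit, ∀ y ∈ LinearMap.ker counit,
    succ (x * y) = succ x * comul y

/-- An unshuffle Hopf algebra in the monoidal category of right comodules over the commutative
bialgebra `(B, δ, ε_B)`: an unshuffle Hopf algebra with a right coaction `ρ` for which all structure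
maps, including the antipode and the half-coproducts on the augmentation ideal, are comodule
morphisms. -/
structure IsUnshuffleHopfInComod {A B : Type*} [Ring A] [Algebra K A] [CommRing B] [Algebra K B]
    (δ : B →ₗ[K] B ⊗[K] B) (εB : B →ₗ[K] K) (ρ : A →ₗ[K] A ⊗[K] B)
    (comul : A →ₗ[K] A ⊗[K] A) (counit : A →ₗ[K] K) (prec succ : A →ₗ[K] A ⊗[K] A) : Prop where
  base : IsBialg δ εB
  unshuffle : IsUnshuffleHopf comul counit prec succ
  comodule : IsRightComodule δ εB ρ
  one_hom : IsComoduleHom (unitCoaction K B) ρ (Algebra.linearMap K A)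
  mul_hom : IsComoduleHom (tensorCoaction ρ ρ) ρ (LinearMap.mul' K A)
  counit_hom : IsComoduleHom ρ (unitCoaction K B) counit
  comul_hom : IsComoduleHom ρ (tensorCoaction ρ ρ) comul
  antipode_hom : ∀ S : A →ₗ[K] A, IsAntipode comul counit S → IsComoduleHom ρ ρ S
  /-- The augmentation ideal is a subcomodule. -/
  aug : ∀ x ∈ LinearMap.ker counit,
    ρ x ∈ LinearMap.range ((LinearMap.ker counit).subtype.rTensor B)
  prec_hom : ∀ x ∈ LinearMap.ker counit, prec.rTensor B (ρ x) = tensorCoaction ρ ρ (prec x)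
  succ_hom : ∀ x ∈ LinearMap.ker counit, succ.rTensor B (ρ x) = tensorCoaction ρ ρ (succ x)

end General

/-! ### Noncrossing partitions -/

/-- A set partition of `{0 < ⋯ < n - 1}`, given as an equivalence relation, is noncrossing. -/
def IsNoncrossing {n : ℕ} (r : Setoid (Fin n)) : Prop :=
  ∀ a c b d : Fin n, a < c → c < b → b < d → r a b → r c d → r a c

/-- Noncrossing partitions of an `n`-element linearly ordered set (standard representatives). -/
def NCOf (n : ℕ) : Type := {r : Setoid (Fin n) // IsNoncrossing r}

instance (n : ℕ) : Finite (NCOf n) := by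
  refine Finite.of_injective (fun P : NCOf n => fun a b => P.1 a b) ?_
  intro P Q h
  apply Subtype.ext
  ext a b
  exact iff_of_eq (congrFun (congrFun h a) b)

instance (n : ℕ) : Fintype (NCOf n) := Fintype.ofFinite _

/-- All noncrossing partitions, the empty one included. -/
structure NCP0 : Type where
  deg : ℕ
  part : NCOf deg

/-- The nonempty noncrossing partitions. -/
def NCP : Type := {P : NCP0 // P.deg ≠ 0}

namespace NCP0

/-- The standardized restriction of `P` to a subset `s` of the underlying set. -/
def restrict (P : NCP0) (s : Finset (Fin P.deg)) : NCP0 where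
  deg := s.card
  part := ⟨Setoid.comap (s.orderEmbOfFin rfl) P.part.1, by
    intro a c b d hac hcb hbd hab hcd
    exact P.part.2 _ _ _ _ ((s.orderEmbOfFin rfl).lt_iff_lt.2 hac)
      ((s.orderEmbOfFin rfl).lt_iff_lt.2 hcb) ((s.orderEmbOfFin rfl).lt_iff_lt.2 hbd) hab hcd⟩

open Classical in
/-- The set of blocks. -/
def blocks (P : NCP0) : Finset (Finset (Fin P.deg)) :=
  Finset.univ.image fun i => Finset.univ.filter fun j => P.part.1 i j

open Classical in
/-- The noncrossing partitions of the same degree that are coarser than or equal to `P`. -/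
def coarsenings (P : NCP0) : Finset (NCOf P.deg) :=
  Finset.univ.filter fun Q => P.part.1 ≤ Q.1

end NCP0

/-- `σ → π`: the convex hull of `σ` meets `π`. -/
def Englobes {n : ℕ} (σ π : Finset (Fin n)) : Prop :=
  ∃ a ∈ σ, ∃ b ∈ σ, ∃ y ∈ π, a ≤ y ∧ y ≤ b

namespace NCP0

open Classical in
/-- The cuts of `P`, each given by its lowerset of blocks; the upperset is the complementary set of
blocks. (A set of blocks is a lowerset for the relation `→` iff it is one for its transitive
closure.) -/
def cuts (P : NCP0) : Finset (Finset (Finset (Fin P.deg))) :=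
  P.blocks.powerset.filter fun L => ∀ π ∈ L, ∀ σ ∈ P.blocks, Englobes σ π → σ ∈ L

/-- The underlying set of a set of blocks. -/
def support {P : NCP0} (L : Finset (Finset (Fin P.deg))) : Finset (Fin P.deg) := L.biUnion id

/-- The lowerset `L` as a (standardized) partition. -/
def lower (P : NCP0) (L : Finset (Finset (Fin P.deg))) : NCP0 := P.restrict (support L)

/-- The `i`-th gap `D_i` determined by the points `x_1 < ⋯ < x_k` of the underlying set of `L`: the
other elements that have exactly `i` of these points below them. -/
def gap {P : NCP0} (L : Finset (Finset (Fin P.deg))) (i : ℕ) : Finset (Fin P.deg) :=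
  Finset.univ.filter fun y => y ∉ support L ∧ ((support L).filter fun x => x < y).card = i

/-- The list `U_0, …, U_k` of partitions in the gaps of `L`, empty ones included. -/
def gapList (P : NCP0) (L : Finset (Finset (Fin P.deg))) : List NCP0 :=
  (List.range ((support L).card + 1)).map fun i => P.restrict (gap L i)

end NCP0

/-! ### The gap-insertion bialgebra, its quotient, and the block-substitution bialgebra -/

section Algebras

variable (K : Type*) [Field K]

/-- The algebra `B_gap^NC`: free associative on all noncrossing partitions, the empty one included. -/
abbrev Bgap : Type _ := FreeAlgebra K NCP0

/-- The algebra `H_gap^NC`: free associative on the nonempty noncrossing partitions. -/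
abbrev Hgap : Type _ := FreeAlgebra K NCP

/-- The algebra `B_bl^NC`: free commutative on the nonempty noncrossing partitions. -/
abbrev Bbl : Type _ := MvPolynomial NCP K

variable {K}

/-- The empty partition. -/
def emptyNCP0 : NCP0 where
  deg := 0
  part := ⟨⊥, fun a => a.elim0⟩

open Classical in
/-- A noncrossing partition as an element of `H_gap^NC`, where the empty partition is `1`. -/
def hgen (P : NCP0) : Hgap K := if h : P.deg ≠ 0 then FreeAlgebra.ι K (⟨P, h⟩ : NCP) else 1

open Classical in
/-- A nonempty noncrossing partition as an element of `B_bl^NC`. (Blocks being nonempty, the value on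
the empty partition plays no role in the definitions below.) -/
def blgen (P : NCP0) : Bbl K := if h : P.deg ≠ 0 then MvPolynomial.X (⟨P, h⟩ : NCP) else 1

/-- The projection `B_gap^NC → H_gap^NC`, sending the empty partition to `1`. -/
def proj : Bgap K →ₐ[K] Hgap K := FreeAlgebra.lift K hgen

/-- The coproduct `Δ₀` of `B_gap^NC`. -/
def comulBgap : Bgap K →ₐ[K] Bgap K ⊗[K] Bgap K :=
  FreeAlgebra.lift K fun P => ∑ L ∈ P.cuts,
    FreeAlgebra.ι K (P.lower L) ⊗ₜ[K] ((P.gapList L).map (FreeAlgebra.ι K)).prod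

open Classical in
/-- The counit of `B_gap^NC`: `0` on nonempty partitions, `1` on the empty partition. -/
def counitBgap : Bgap K →ₐ[K] K := FreeAlgebra.lift K fun P => if P.deg = 0 then 1 else 0

/-- The reduced gap monomial of the upperset complementary to `L`. -/
def redGapMonomial (P : NCP0) (L : Finset (Finset (Fin P.deg))) : Hgap K :=
  ((P.gapList L).map hgen).prod

/-- The coproduct `Δ` of `H_gap^NC`. -/
def comulHgap : Hgap K →ₐ[K] Hgap K ⊗[K] Hgap K :=
  FreeAlgebra.lift K fun P => ∑ L ∈ P.1.cuts, hgen (P.1.lower L) ⊗ₜ[K] redGapMonomial P.1 L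

/-- The counit of `H_gap^NC`, which vanishes on nonempty partitions. -/
def counitHgap : Hgap K →ₐ[K] K := FreeAlgebra.lift K fun _ => 0

/-- The cuts of a multipartition `P_1 ⋯ P_k`: sequences of cuts of the `P_i`. -/
def multiCuts (w : List NCP) :
    Finset ((i : Fin w.length) → Finset (Finset (Fin (w.get i).1.deg))) :=
  Fintype.piFinset fun i => (w.get i).1.cuts

/-- The term `L ⊗ U` in `H_gap^NC ⊗ H_gap^NC` of a cut of a multipartition: the monomial of the
lowersets, and the product of the reduced gap monomials of the uppersets. -/
def cutTerm (w : List NCP) (c : (i : Fin w.length) → Finset (Finset (Fin (w.get i).1.deg))) :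
    Hgap K ⊗[K] Hgap K :=
  (List.ofFn fun i => hgen (K := K) ((w.get i).1.lower (c i))).prod ⊗ₜ[K]
    (List.ofFn fun i => redGapMonomial (K := K) (w.get i).1 (c i)).prod

/-- The first element of the multipartition belongs to the lowerset of the cut. -/
def FirstInLower (w : List NCP)
    (c : (i : Fin w.length) → Finset (Finset (Fin (w.get i).1.deg))) : Prop :=
  ∃ i : Fin w.length, i.val = 0 ∧ ∃ x, x.val = 0 ∧ x ∈ NCP0.support (c i)

/-- The first element of the multipartition belongs to the upperset of the cut. -/
def FirstInUpper (w : List NCP)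
    (c : (i : Fin w.length) → Finset (Finset (Fin (w.get i).1.deg))) : Prop :=
  ∃ i : Fin w.length, i.val = 0 ∧ ∃ x, x.val = 0 ∧ x ∉ NCP0.support (c i)

open Classical in
/-- The half-coproduct `Δ_≺`, defined on the basis of multipartitions (words): the sum over the cuts
with the first element in the lowerset. On the empty word, which is outside the augmentation ideal,
the sum is empty. -/
def precHgap : Hgap K →ₗ[K] Hgap K ⊗[K] Hgap K :=
  (FreeAlgebra.basisFreeMonoid K NCP).constr K fun w =>
    ∑ c ∈ (multiCuts w.toList).filter (FirstInLower w.toList), cutTerm w.toList c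

open Classical in
/-- The half-coproduct `Δ_≻`: the sum over the cuts with the first element in the upperset. -/
def succHgap : Hgap K →ₗ[K] Hgap K ⊗[K] Hgap K :=
  (FreeAlgebra.basisFreeMonoid K NCP).constr K fun w =>
    ∑ c ∈ (multiCuts w.toList).filter (FirstInUpper w.toList), cutTerm w.toList c

/-- The fibre monomial `P/Q`, the product over the blocks of `Q` of the restrictions of `P`. -/
def fibre (P : NCP0) (Q : NCOf P.deg) : Bbl K :=
  ∏ τ ∈ (NCP0.mk P.deg Q).blocks, blgen (P.restrict τ)

/-- The coproduct `δ` of `B_bl^NC`, `P ↦ ∑_{P ≤ Q} Q ⊗ P/Q`. -/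
def comulBbl : Bbl K →ₐ[K] Bbl K ⊗[K] Bbl K :=
  MvPolynomial.aeval fun P : NCP => ∑ Q ∈ P.1.coarsenings,
    blgen (K := K) ⟨P.1.deg, Q⟩ ⊗ₜ[K] fibre (K := K) P.1 Q

open Classical in
/-- The counit of `B_bl^NC`: `1` on one-block partitions, `0` on the other partitions. -/
def counitBbl : Bbl K →ₐ[K] K :=
  MvPolynomial.aeval fun P : NCP => if P.1.blocks.card = 1 then (1 : K) else 0

/-- The coaction `ρ : B_gap^NC → B_gap^NC ⊗ B_bl^NC`, `P ↦ ∑_{P ≤ Q} Q ⊗ P/Q`. -/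
def coactBgap : Bgap K →ₐ[K] Bgap K ⊗[K] Bbl K :=
  FreeAlgebra.lift K fun P => ∑ Q ∈ P.coarsenings,
    FreeAlgebra.ι K (NCP0.mk P.deg Q) ⊗ₜ[K] fibre (K := K) P Q

/-- The coaction `ρ : H_gap^NC → H_gap^NC ⊗ B_bl^NC`, `P ↦ ∑_{P ≤ Q} Q ⊗ P/Q`. -/
def coactHgap : Hgap K →ₐ[K] Hgap K ⊗[K] Bbl K :=
  FreeAlgebra.lift K fun P => ∑ Q ∈ P.1.coarsenings,
    hgen (K := K) ⟨P.1.deg, Q⟩ ⊗ₜ[K] fibre (K := K) P.1 Q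

end Algebras

end

/-!
A cut of a noncrossing partition `P` is encoded by the underlying set `S` of its lowerset. The
first point is that `S` underlies a cut if and only if `P` refines the partition of the underlying
set into `S` and the gaps of `S` (`isCut_iff`), and that this partition is noncrossing
(`cutPart_noncrossing`). All the sums in the statement can therefore be reindexed by gluing:
cuts contained in a cut are cuts of its lower part (`sum_cutSets_restrict`), cuts containing a cut
are families of cuts of its gaps (`sum_piFinset_cutSets`), and coarsenings for which `S` is still a
cut are families of coarsenings of the restrictions to `S` and to its gaps
(`sum_piFinset_coarsenings`).

Both iterated coproducts of a generator `P` then become sums of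
`P|T ⊗ ∏ P|(S ∩ D_j) ⊗ ∏ P|E_i` over the nested cuts `T ⊆ S`, where the `D_j` and the `E_i` are
the gaps of `T` and of `S`. This gives coassociativity. Recording whether the first element lies in
`T`, in `S` but not in `T`, or outside `S` gives the three codendriform relations on generators.
They extend to the augmentation ideal because it is generated, as a right ideal, by the nonempty
partitions (`eq_of_mem_ker`), and because both half-coproducts `D` satisfy `D(xy) = D(x) Δ(y)`
there (`IsHalf.mul`). The antipode of a generator is defined by recursion on the degree, so that it
is a left convolution inverse of the identity on generators; it extends as an antimorphism of
algebras, and associativity of the convolution product makes it a right inverse too.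

The axioms for `B_bl^NC` and for the coaction come from gluing along the blocks of a partition
(`comulBbl_fibre`). The compatibility of `ρ` with `Δ`, `Δ_≺` and `Δ_≻` on generators is
gluing along a cut (`tensorCoaction_cut`), together with an exchange of the sums over cuts and over
coarsenings; it is again extended multiplicatively. That the antipode is a comodule morphism is
formal: `(S ⊗ Id) ρ` and `ρ S` are convolution inverses, on the two sides, of `ρ`
(`isComoduleHom_antipode`).
-/

-- Unfolding these is needed for the degree of a restriction to be recognized as a cardinality.
attribute [reducible] NCOf NCP NCP0.restrict

open scoped TensorProduct

noncomputable section

/-! ### Standardization of subsets and restrictions -/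

namespace NCP0

/-- The increasing enumeration of `s`, along which restrictions to `s` are standardized. -/
abbrev emb {n : ℕ} (s : Finset (Fin n)) : Fin s.card ↪o Fin n := s.orderEmbOfFin rfl

/-- The subset of `s` whose standardization is `t`. -/
def up {n : ℕ} (s : Finset (Fin n)) (t : Finset (Fin s.card)) : Finset (Fin n) :=
  t.map (emb s).toEmbedding

/-- The standardization of `S ∩ s` as a subset of `s`. -/
def down {n : ℕ} (s S : Finset (Fin n)) : Finset (Fin s.card) :=
  Finset.univ.filter fun i => emb s i ∈ S

section Standardization

variable {n : ℕ} {s S : Finset (Fin n)} {t : Finset (Fin s.card)}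

theorem emb_mem (s : Finset (Fin n)) (i : Fin s.card) : emb s i ∈ s :=
  s.orderEmbOfFin_mem rfl i

theorem exists_emb_eq {y : Fin n} (hy : y ∈ s) : ∃ i, emb s i = y := by
  have h := s.range_orderEmbOfFin rfl
  have : y ∈ Set.range (s.orderEmbOfFin rfl) := by rw [h]; exact hy
  exact this

theorem mem_up {y : Fin n} : y ∈ up s t ↔ ∃ i ∈ t, emb s i = y := by
  simp [up]

@[simp]
theorem emb_mem_up {i : Fin s.card} : emb s i ∈ up s t ↔ i ∈ t := by
  simp [up]

@[simp]
theorem mem_down {i : Fin s.card} : i ∈ down s S ↔ emb s i ∈ S := by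
  simp [down]

@[simp]
theorem card_up : (up s t).card = t.card := Finset.card_map _

theorem up_subset (s : Finset (Fin n)) (t : Finset (Fin s.card)) : up s t ⊆ s := by
  intro y hy
  obtain ⟨i, -, rfl⟩ := mem_up.1 hy
  exact emb_mem s i

theorem up_eq_iff {X : Finset (Fin n)} (hX : X ⊆ s) :
    up s t = X ↔ ∀ i, i ∈ t ↔ emb s i ∈ X := by
  constructor
  · rintro rfl i
    simp
  · intro h
    ext y
    rw [mem_up]
    constructor
    · rintro ⟨i, hi, rfl⟩
      exact (h i).1 hi
    · intro hy
      obtain ⟨i, rfl⟩ := exists_emb_eq (hX hy)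
      exact ⟨i, (h i).2 hy, rfl⟩

theorem up_down (s S : Finset (Fin n)) : up s (down s S) = S ∩ s :=
  (up_eq_iff Finset.inter_subset_right).2 fun i => by simp

theorem down_up : down s (up s t) = t := by
  ext i
  simp

theorem card_filter_lt_emb (t : Finset (Fin s.card)) (i : Fin s.card) :
    ((up s t).filter (· < emb s i)).card = (t.filter (· < i)).card := by
  rw [up, Finset.filter_map, Finset.card_map]
  congr 1
  ext j
  simp

end Standardization

/-- Partitions being standard representatives, isomorphic partitions are equal. -/
theorem eq_of_orderIso {P Q : NCP0} (e : Fin P.deg ≃o Fin Q.deg)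
    (h : ∀ a b, P.part.1 a b ↔ Q.part.1 (e a) (e b)) : P = Q := by
  obtain ⟨n, P⟩ := P
  obtain ⟨m, Q⟩ := Q
  obtain rfl : n = m := by simpa using Fintype.card_congr e.toEquiv
  have he : e = OrderIso.refl _ := Subsingleton.elim _ _
  subst he
  congr 1
  exact Subtype.ext (Setoid.ext h)

theorem restrict_rel (P : NCP0) (s : Finset (Fin P.deg)) (i j : Fin s.card) :
    (P.restrict s).part.1 i j ↔ P.part.1 (emb s i) (emb s j) := Iff.rfl

theorem restrict_restrict (P : NCP0) (s : Finset (Fin P.deg)) (t : Finset (Fin s.card)) :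
    (P.restrict s).restrict t = P.restrict (up s t) := by
  have hc : t.card = (up s t).card := card_up.symm
  have key : ∀ i : Fin t.card, emb (up s t) (Fin.castOrderIso hc i) = emb s (emb t i) := by
    intro i
    have := Finset.orderEmbOfFin_unique (s := up s t) (k := t.card) hc.symm
      (f := fun i => emb s (emb t i)) (fun i => emb_mem_up.2 (emb_mem t i))
      ((emb s).strictMono.comp (emb t).strictMono)
    have h2 := Finset.orderEmbOfFin_unique (s := up s t) (k := t.card) hc.symm
      (f := fun i => emb (up s t) (Fin.castOrderIso hc i)) (fun i => emb_mem _ _)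
      ((emb (up s t)).strictMono.comp (Fin.castOrderIso hc).strictMono)
    exact (congrFun h2 i).trans (congrFun this i).symm
  refine eq_of_orderIso (Fin.castOrderIso hc) fun a b => ?_
  exact iff_of_eq (congrArg₂ (fun x y => P.part.1 x y) (key a).symm (key b).symm)

theorem restrict_univ (P : NCP0) : P.restrict Finset.univ = P := by
  have hc : (Finset.univ : Finset (Fin P.deg)).card = P.deg := by simp
  have key : ∀ i, emb (Finset.univ : Finset (Fin P.deg)) i = Fin.castOrderIso hc i := by
    intro i
    have := Finset.orderEmbOfFin_unique (s := (Finset.univ : Finset (Fin P.deg))) rfl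
      (f := fun i => Fin.castOrderIso hc i) (fun i => Finset.mem_univ _)
      (Fin.castOrderIso hc).strictMono
    exact (congrFun this i).symm
  refine eq_of_orderIso (Fin.castOrderIso hc) fun a b => ?_
  exact iff_of_eq (congrArg₂ (fun x y => P.part.1 x y) (key a) (key b))

theorem eq_of_deg_eq_zero {P Q : NCP0} (hP : P.deg = 0) (hQ : Q.deg = 0) : P = Q := by
  refine eq_of_orderIso (Fin.castOrderIso (hP.trans hQ.symm)) fun a => ?_
  exact absurd a.2 (by omega)

/-! ### Blocks -/

open Classical in
/-- The block of the element `i`. -/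
def blockOf (P : NCP0) (i : Fin P.deg) : Finset (Fin P.deg) :=
  Finset.univ.filter fun j => P.part.1 i j

section Blocks

variable {P : NCP0} {τ σ : Finset (Fin P.deg)}

theorem mem_blockOf {i j : Fin P.deg} : j ∈ P.blockOf i ↔ P.part.1 i j := by
  simp [blockOf]

theorem self_mem_blockOf (i : Fin P.deg) : i ∈ P.blockOf i :=
  mem_blockOf.2 (P.part.1.refl' i)

theorem mem_blocks : τ ∈ P.blocks ↔ ∃ i, P.blockOf i = τ := by
  simp [blocks, blockOf]

theorem blockOf_mem (i : Fin P.deg) : P.blockOf i ∈ P.blocks := mem_blocks.2 ⟨i, rfl⟩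

theorem blockOf_eq_iff {i j : Fin P.deg} : P.blockOf i = P.blockOf j ↔ P.part.1 i j := by
  constructor
  · intro h
    exact mem_blockOf.1 (h ▸ self_mem_blockOf j)
  · intro h
    ext k
    rw [mem_blockOf, mem_blockOf]
    exact ⟨fun h' => P.part.1.trans' (P.part.1.symm' h) h', fun h' => P.part.1.trans' h h'⟩

theorem eq_blockOf (hτ : τ ∈ P.blocks) {i : Fin P.deg} (hi : i ∈ τ) : τ = P.blockOf i := by
  obtain ⟨j, rfl⟩ := mem_blocks.1 hτ
  exact blockOf_eq_iff.2 (mem_blockOf.1 hi)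

theorem rel_of_mem_block (hτ : τ ∈ P.blocks) {i j : Fin P.deg} (hi : i ∈ τ) (hj : j ∈ τ) :
    P.part.1 i j := by
  rw [eq_blockOf hτ hi] at hj
  exact mem_blockOf.1 hj

theorem block_nonempty (hτ : τ ∈ P.blocks) : τ.Nonempty := by
  obtain ⟨j, rfl⟩ := mem_blocks.1 hτ
  exact ⟨j, self_mem_blockOf j⟩

theorem card_blocks_eq_one (hP : P.deg ≠ 0) :
    P.blocks.card = 1 ↔ ∀ a b, P.part.1 a b := by
  rw [Finset.card_eq_one]
  constructor
  · rintro ⟨τ, hτ⟩ a b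
    have ha := blockOf_mem a
    have hb := blockOf_mem b
    rw [hτ, Finset.mem_singleton] at ha hb
    exact blockOf_eq_iff.1 (ha.trans hb.symm)
  · intro h
    refine ⟨P.blockOf ⟨0, Nat.pos_of_ne_zero hP⟩, ?_⟩
    ext τ
    rw [Finset.mem_singleton, mem_blocks]
    constructor
    · rintro ⟨i, rfl⟩
      exact blockOf_eq_iff.2 (h _ _)
    · rintro rfl
      exact ⟨_, rfl⟩

end Blocks

/-! ### Cuts as sets of elements -/

/-- `S` is the underlying set of a lowerset of blocks of `P`: with each of its elements `y`, it
contains all blocks whose convex hull contains `y`. -/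
def IsCut (P : NCP0) (S : Finset (Fin P.deg)) : Prop :=
  ∀ a b y, P.part.1 a b → a ≤ y → y ≤ b → y ∈ S → a ∈ S ∧ b ∈ S

open Classical in
/-- The underlying sets of the lowersets of blocks of `P`. -/
def cutSets (P : NCP0) : Finset (Finset (Fin P.deg)) := Finset.univ.filter P.IsCut

theorem mem_cutSets {P : NCP0} {S : Finset (Fin P.deg)} : S ∈ P.cutSets ↔ P.IsCut S := by
  simp [cutSets]

open Classical in
/-- The cuts satisfying the condition `p`. -/
def cutsWith (P : NCP0) (p : Finset (Fin P.deg) → Prop) : Finset (Finset (Fin P.deg)) :=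
  P.cutSets.filter p

section CutsWith

variable {P : NCP0} {p q : Finset (Fin P.deg) → Prop}

theorem mem_cutsWith {S : Finset (Fin P.deg)} : S ∈ P.cutsWith p ↔ S ∈ P.cutSets ∧ p S := by
  simp [cutsWith]

theorem cutsWith_congr (h : ∀ S ∈ P.cutSets, p S ↔ q S) : P.cutsWith p = P.cutsWith q := by
  ext S
  rw [mem_cutsWith, mem_cutsWith]
  exact and_congr_right (h S)

theorem cutsWith_true (h : ∀ S, p S) : P.cutsWith p = P.cutSets := by
  ext S
  rw [mem_cutsWith]
  exact and_iff_left (h S)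

theorem sum_cutsWith {M : Type*} [AddCommMonoid M] [DecidablePred p]
    (f : Finset (Fin P.deg) → M) :
    ∑ S ∈ P.cutsWith p, f S = ∑ S ∈ P.cutSets, if p S then f S else 0 := by
  rw [← Finset.sum_filter, cutsWith]
  congr!

theorem sum_cutsWith_and {M : Type*} [AddCommMonoid M] [DecidablePred q]
    (f : Finset (Fin P.deg) → M) :
    ∑ S ∈ P.cutsWith p, (if q S then f S else 0) = ∑ S ∈ P.cutsWith fun S => p S ∧ q S, f S := by
  classical
  rw [cutsWith, ← Finset.sum_filter, Finset.filter_filter, cutsWith]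
  congr!

theorem sum_cutsWith_add_not {M : Type*} [AddCommMonoid M] (f : Finset (Fin P.deg) → M) :
    ∑ S ∈ P.cutsWith p, f S + ∑ S ∈ P.cutsWith fun S => ¬ p S, f S = ∑ S ∈ P.cutSets, f S := by
  classical
  rw [sum_cutsWith, sum_cutsWith, ← Finset.sum_add_distrib]
  refine Finset.sum_congr rfl fun S _ => ?_
  by_cases h : p S <;> simp [h]

end CutsWith

theorem IsCut.mem_of_rel {P : NCP0} {S : Finset (Fin P.deg)} (hS : P.IsCut S) {a b : Fin P.deg}
    (h : P.part.1 a b) (ha : a ∈ S) : b ∈ S := by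
  rcases le_total a b with hab | hab
  · exact (hS a b a h le_rfl hab ha).2
  · exact (hS b a a (P.part.1.symm' h) hab le_rfl ha).1

/-- The cuts of `P`, which are sets of blocks, correspond to the sets `S` of elements with
`P.IsCut S`. -/
theorem sum_cuts {M : Type*} [AddCommMonoid M] (P : NCP0) (F : Finset (Fin P.deg) → M) :
    ∑ L ∈ P.cuts, F (support L) = ∑ S ∈ P.cutSets, F S := by
  classical
  have hsupp : ∀ L : Finset (Finset (Fin P.deg)), ∀ y, y ∈ support L ↔ ∃ τ ∈ L, y ∈ τ := by
    intro L y
    simp [support]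
  have hmem : ∀ L, L ∈ P.cuts ↔ L ⊆ P.blocks ∧
      ∀ π ∈ L, ∀ σ ∈ P.blocks, Englobes σ π → σ ∈ L := by
    intro L
    simp [cuts]
  refine Finset.sum_nbij' support (fun S => P.blocks.filter (· ⊆ S)) ?_ ?_ ?_ ?_ ?_
  · intro L hL
    obtain ⟨hLb, hL⟩ := (hmem L).1 hL
    refine mem_cutSets.2 fun a b y hab hay hyb hy => ?_
    obtain ⟨π, hπ, hyπ⟩ := (hsupp L y).1 hy
    have hb : b ∈ P.blockOf a := mem_blockOf.2 hab
    have := hL π hπ (P.blockOf a) (blockOf_mem a)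
      ⟨a, self_mem_blockOf a, b, hb, y, hyπ, hay, hyb⟩
    exact ⟨(hsupp L a).2 ⟨_, this, self_mem_blockOf a⟩, (hsupp L b).2 ⟨_, this, hb⟩⟩
  · intro S hS
    have hS := mem_cutSets.1 hS
    refine (hmem _).2 ⟨Finset.filter_subset _ _, fun π hπ σ hσ hE => ?_⟩
    obtain ⟨a, ha, b, hb, y, hy, hay, hyb⟩ := hE
    refine Finset.mem_filter.2 ⟨hσ, fun z hz => ?_⟩
    have := hS a b y (rel_of_mem_block hσ ha hb) hay hyb ((Finset.mem_filter.1 hπ).2 hy)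
    exact hS.mem_of_rel (rel_of_mem_block hσ ha hz) this.1
  · intro L hL
    obtain ⟨hLb, hL⟩ := (hmem L).1 hL
    ext σ
    rw [Finset.mem_filter]
    constructor
    · rintro ⟨hσ, hsub⟩
      obtain ⟨x, hx⟩ := block_nonempty hσ
      obtain ⟨π, hπ, hxπ⟩ := (hsupp L x).1 (hsub hx)
      rwa [eq_blockOf hσ hx, ← eq_blockOf (hLb hπ) hxπ]
    · intro hσ
      exact ⟨hLb hσ, fun x hx => (hsupp L x).2 ⟨σ, hσ, hx⟩⟩
  · intro S hS
    have hS := mem_cutSets.1 hS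
    ext y
    rw [hsupp]
    constructor
    · rintro ⟨τ, hτ, hy⟩
      exact (Finset.mem_filter.1 hτ).2 hy
    · intro hy
      exact ⟨P.blockOf y, Finset.mem_filter.2 ⟨blockOf_mem y, fun z hz =>
        hS.mem_of_rel (mem_blockOf.1 hz) hy⟩, self_mem_blockOf y⟩
  · intro L _
    rfl

theorem IsCut.empty (P : NCP0) : P.IsCut ∅ := fun _ _ _ _ _ _ h => absurd h (by simp)

theorem IsCut.univ (P : NCP0) : P.IsCut Finset.univ := fun _ _ _ _ _ _ _ => by simp

theorem isCut_up {P : NCP0} {S : Finset (Fin P.deg)} {T : Finset (Fin S.card)}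
    (hS : P.IsCut S) (hT : (P.restrict S).IsCut T) : P.IsCut (up S T) := by
  intro a b y hab hay hyb hy
  obtain ⟨i, hi, rfl⟩ := mem_up.1 hy
  obtain ⟨ha, hb⟩ := hS a b _ hab hay hyb (emb_mem S i)
  obtain ⟨a, rfl⟩ := exists_emb_eq ha
  obtain ⟨b, rfl⟩ := exists_emb_eq hb
  simp only [emb_mem_up]
  exact hT a b i hab ((emb S).le_iff_le.1 hay) ((emb S).le_iff_le.1 hyb) hi

theorem isCut_down {P : NCP0} {T : Finset (Fin P.deg)} (hT : P.IsCut T)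
    (S : Finset (Fin P.deg)) : (P.restrict S).IsCut (down S T) := by
  intro a b y hab hay hyb hy
  have := hT (emb S a) (emb S b) (emb S y) hab ((emb S).le_iff_le.2 hay)
    ((emb S).le_iff_le.2 hyb) (mem_down.1 hy)
  exact ⟨mem_down.2 this.1, mem_down.2 this.2⟩

/-- The cuts of the lower part of a cut `S` are the cuts contained in `S`. -/
theorem sum_cutSets_restrict {M : Type*} [AddCommMonoid M] {P : NCP0} {S : Finset (Fin P.deg)}
    (hS : P.IsCut S) (F : Finset (Fin P.deg) → M) :
    ∑ T ∈ (P.restrict S).cutSets, F (up S T) = ∑ T ∈ P.cutsWith fun T => T ⊆ S, F T := by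
  refine Finset.sum_nbij' (fun T => up S T) (fun T => down S T) ?_ ?_ ?_ ?_ ?_
  · intro T hT
    exact mem_cutsWith.2 ⟨mem_cutSets.2 (isCut_up hS (mem_cutSets.1 hT)), up_subset S T⟩
  · intro T hT
    exact mem_cutSets.2 (isCut_down (mem_cutSets.1 (mem_cutsWith.1 hT).1) S)
  · intro T _
    exact down_up
  · intro T hT
    exact (up_down S T).trans (Finset.inter_eq_left.2 (mem_cutsWith.1 hT).2)
  · intro T _
    rfl

end NCP0

namespace NCP0

/-! ### Gaps -/

/-- The elements outside `S` that have exactly `i` elements of `S` below them. -/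
def gapOf {n : ℕ} (S : Finset (Fin n)) (i : ℕ) : Finset (Fin n) :=
  Finset.univ.filter fun y => y ∉ S ∧ (S.filter fun x => x < y).card = i

section Gaps

variable {n : ℕ} {S T : Finset (Fin n)}

theorem mem_gapOf {i : ℕ} {y : Fin n} :
    y ∈ gapOf S i ↔ y ∉ S ∧ (S.filter (· < y)).card = i := by
  simp [gapOf]

theorem up_gapOf (t : Finset (Fin S.card)) (i : ℕ) :
    up S (gapOf t i) = S ∩ gapOf (up S t) i := by
  refine (up_eq_iff Finset.inter_subset_left).2 fun j => ?_
  rw [mem_gapOf, Finset.mem_inter, mem_gapOf, emb_mem_up, card_filter_lt_emb]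
  exact (and_iff_right (emb_mem S j)).symm

theorem card_filter_lt_mono {y z : Fin n} (h : y ≤ z) :
    (S.filter (· < y)).card ≤ (S.filter (· < z)).card :=
  Finset.card_le_card fun x hx => by
    rw [Finset.mem_filter] at hx ⊢
    exact ⟨hx.1, hx.2.trans_le h⟩

theorem card_filter_lt_le (y : Fin n) : (S.filter (· < y)).card ≤ S.card :=
  Finset.card_filter_le _ _

/-- Two elements are separated by no element of `S` if and only if they have the same number of
elements of `S` below them. -/
theorem card_filter_lt_eq_iff {y z : Fin n} (hz : z ∉ S) (h : y ≤ z) :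
    (S.filter (· < y)).card = (S.filter (· < z)).card ↔ ∀ x ∈ S, ¬ (y ≤ x ∧ x ≤ z) := by
  have hsub : S.filter (· < y) ⊆ S.filter (· < z) := fun x hx => by
    rw [Finset.mem_filter] at hx ⊢
    exact ⟨hx.1, hx.2.trans_le h⟩
  constructor
  · intro hc x hx hyx
    have heq := Finset.eq_of_subset_of_card_le hsub hc.ge
    have hxz : x < z := lt_of_le_of_ne hyx.2 fun e => hz (e ▸ hx)
    have : x ∈ S.filter (· < y) := heq ▸ Finset.mem_filter.2 ⟨hx, hxz⟩
    exact absurd (Finset.mem_filter.1 this).2 (not_lt.2 hyx.1)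
  · intro hx
    congr 1
    refine Finset.Subset.antisymm hsub fun x hxz => ?_
    rw [Finset.mem_filter] at hxz ⊢
    refine ⟨hxz.1, ?_⟩
    by_contra hlt
    exact hx x hxz.1 ⟨not_lt.1 hlt, hxz.2.le⟩

/-- The elements of `S` between `T` and `y`, sorted by the gap of `T` they lie in. -/
theorem card_filter_lt_of_mem_gapOf (hTS : T ⊆ S) {j : ℕ} {y : Fin n} (hy : y ∈ gapOf T j) :
    (S.filter (· < y)).card = (∑ l ∈ Finset.range j, ((S ∩ gapOf T l).card + 1))
      + ((S ∩ gapOf T j).filter (· < y)).card := by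
  obtain ⟨hyT, hj⟩ := mem_gapOf.1 hy
  have h1 : (S.filter (· < y)).card = (T.filter (· < y)).card
      + ((S \ T).filter (· < y)).card := by
    rw [← Finset.card_union_of_disjoint, ← Finset.filter_union, Finset.union_sdiff_of_subset hTS]
    exact Finset.disjoint_filter_filter (Finset.disjoint_sdiff)
  have hmaps : ∀ z ∈ (S \ T).filter (· < y), (T.filter (· < z)).card ∈ Finset.range (j + 1) := by
    intro z hz
    rw [Finset.mem_range, Nat.lt_succ_iff, ← hj]
    exact card_filter_lt_mono (Finset.mem_filter.1 hz).2.le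
  rw [h1, hj, Finset.card_eq_sum_card_fiberwise hmaps, Finset.sum_range_succ,
    Finset.sum_add_distrib, Finset.sum_const, Finset.card_range, smul_eq_mul, mul_one]
  have h2 : ∀ l, ((S \ T).filter (· < y)).filter (fun z => (T.filter (· < z)).card = l)
      = (S ∩ gapOf T l).filter (· < y) := by
    intro l
    ext z
    simp only [Finset.mem_filter, Finset.mem_sdiff, Finset.mem_inter, mem_gapOf]
    tauto
  have h3 : ∀ l ∈ Finset.range j, (S ∩ gapOf T l).filter (· < y) = S ∩ gapOf T l := by
    intro l hl
    refine Finset.filter_true_of_mem fun z hz => ?_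
    have hzl := (mem_gapOf.1 (Finset.mem_inter.1 hz).2).2
    by_contra hlt
    have := card_filter_lt_mono (S := T) (not_lt.1 hlt)
    rw [hj, hzl] at this
    exact absurd (Finset.mem_range.1 hl) (not_lt.2 this)
  simp only [h2]
  rw [Finset.sum_congr rfl fun l hl => congrArg Finset.card (h3 l hl)]
  ring

theorem card_eq_sum_gapOf (hTS : T ⊆ S) :
    S.card + 1 = ∑ l ∈ Finset.range (T.card + 1), ((S ∩ gapOf T l).card + 1) := by
  have h1 : S.card = T.card + (S \ T).card := by
    rw [← Finset.card_union_of_disjoint Finset.disjoint_sdiff, Finset.union_sdiff_of_subset hTS]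
  have hmaps : ∀ z ∈ S \ T, (T.filter (· < z)).card ∈ Finset.range (T.card + 1) := by
    intro z _
    rw [Finset.mem_range, Nat.lt_succ_iff]
    exact card_filter_lt_le z
  have h2 : ∀ l, (S \ T).filter (fun z => (T.filter (· < z)).card = l) = S ∩ gapOf T l := by
    intro l
    ext z
    simp only [Finset.mem_filter, Finset.mem_sdiff, Finset.mem_inter, mem_gapOf]
    tauto
  rw [h1, Finset.card_eq_sum_card_fiberwise hmaps, Finset.sum_add_distrib, Finset.sum_const,
    Finset.card_range, smul_eq_mul, mul_one]
  simp only [h2]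
  ring

/-- For `T ⊆ S`, the gaps of `S` inside the `j`-th gap of `T` are consecutive gaps of `S`. -/
theorem gapOf_inter_gapOf (hTS : T ⊆ S) {j i : ℕ} (hi : i ≤ (S ∩ gapOf T j).card) :
    gapOf T j ∩ gapOf (S ∩ gapOf T j) i
      = gapOf S ((∑ l ∈ Finset.range j, ((S ∩ gapOf T l).card + 1)) + i) := by
  ext y
  rw [Finset.mem_inter, mem_gapOf (S := S), mem_gapOf (S := S ∩ gapOf T j)]
  constructor
  · rintro ⟨hyT, hyS, hc⟩
    refine ⟨fun h => hyS (Finset.mem_inter.2 ⟨h, hyT⟩), ?_⟩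
    rw [card_filter_lt_of_mem_gapOf hTS hyT, hc]
  · rintro ⟨hyS, hc⟩
    have hy : y ∈ gapOf T (T.filter (· < y)).card := mem_gapOf.2 ⟨fun h => hyS (hTS h), rfl⟩
    generalize (T.filter (· < y)).card = j' at hy
    have hcard := card_filter_lt_of_mem_gapOf hTS hy
    rw [hc] at hcard
    have hle := Finset.card_filter_le (S ∩ gapOf T j') (· < y)
    -- the position of `y` determines the gap of `T` it lies in
    have hmono : ∀ p q : ℕ, p < q → (∑ l ∈ Finset.range p, ((S ∩ gapOf T l).card + 1))
        + ((S ∩ gapOf T p).card + 1) ≤ ∑ l ∈ Finset.range q, ((S ∩ gapOf T l).card + 1) := by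
      intro p q hpq
      rw [← Finset.sum_range_succ]
      exact Finset.sum_le_sum_of_subset (Finset.range_mono hpq)
    obtain rfl : j' = j := by
      rcases lt_trichotomy j' j with h | h | h
      · have := hmono _ _ h
        omega
      · exact h
      · have := hmono _ _ h
        omega
    exact ⟨hy, fun h => hyS (Finset.mem_inter.1 h).1, by omega⟩

/-- A product over consecutive intervals of indices is the product over their union. -/
theorem prod_range_map_add {M : Type*} [Monoid M] (g : ℕ → M) (k : ℕ → ℕ) (m : ℕ) :
    ((List.range m).map fun j => ((List.range (k j)).map fun i =>
      g ((∑ l ∈ Finset.range j, k l) + i)).prod).prod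
      = ((List.range (∑ l ∈ Finset.range m, k l)).map g).prod := by
  induction m with
  | zero => simp
  | succ m ih =>
    rw [List.range_succ, List.map_append, List.prod_append, ih, Finset.sum_range_succ,
      List.range_add, List.map_append, List.prod_append]
    simp [Function.comp_def]

theorem list_ofFn_val {α : Type*} (m : ℕ) (g : ℕ → α) :
    (List.ofFn fun i : Fin m => g i.val) = (List.range m).map g := by
  refine List.ext_getElem (by simp) fun i h1 h2 => by simp

end Gaps

/-! ### Cuts and gaps -/

section Glue

variable {P : NCP0} {T : Finset (Fin P.deg)}

/-- A block outside a cut lies in a single gap. -/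
theorem IsCut.mem_gapOf_of_between (hT : P.IsCut T) {j : ℕ} {a b y : Fin P.deg}
    (hab : P.part.1 a b) (haT : a ∉ T) (hay : a ≤ y) (hyb : y ≤ b) :
    (a ∈ gapOf T j ↔ y ∈ gapOf T j) ∧ (b ∈ gapOf T j ↔ y ∈ gapOf T j) := by
  have hbT : b ∉ T := fun hb => haT (hT.mem_of_rel (P.part.1.symm' hab) hb)
  have hbetween : ∀ x ∈ T, ¬ (a ≤ x ∧ x ≤ b) := fun x hx h => haT (hT a b x hab h.1 h.2 hx).1
  have hyT : y ∉ T := fun hy => hbetween y hy ⟨hay, hyb⟩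
  have h1 := (card_filter_lt_eq_iff hyT hay).2 fun x hx h => hbetween x hx ⟨h.1, h.2.trans hyb⟩
  have h2 := (card_filter_lt_eq_iff hbT hyb).2 fun x hx h => hbetween x hx ⟨hay.trans h.1, h.2⟩
  simp only [mem_gapOf, haT, hbT, hyT, h1, ← h2, and_self]

/-- Cuts of the partitions in the gaps of a cut `T` amount to a cut containing `T`. -/
theorem sum_piFinset_cutSets {M : Type*} [AddCommMonoid M] (hT : P.IsCut T)
    (G : ((j : Fin (T.card + 1)) → Finset (Fin (gapOf T j).card)) → M) :
    ∑ x ∈ Fintype.piFinset fun j : Fin (T.card + 1) => (P.restrict (gapOf T j)).cutSets, G x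
      = ∑ S ∈ P.cutsWith fun S => T ⊆ S, G fun j => down (gapOf T j) S := by
  classical
  symm
  refine Finset.sum_bij (fun S _ j => down (gapOf T j) S) ?_ ?_ ?_ fun _ _ => rfl
  · intro S hS
    exact Fintype.mem_piFinset.2 fun j =>
      mem_cutSets.2 (isCut_down (mem_cutSets.1 (mem_cutsWith.1 hS).1) _)
  · intro S hS S' hS' h
    have hTS := (mem_cutsWith.1 hS).2
    have hTS' := (mem_cutsWith.1 hS').2
    ext y
    by_cases hy : y ∈ T
    · exact iff_of_true (hTS hy) (hTS' hy)
    · have hj : y ∈ gapOf T (⟨_, Nat.lt_succ_of_le (card_filter_lt_le y)⟩ : Fin (T.card + 1)) :=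
        mem_gapOf.2 ⟨hy, rfl⟩
      obtain ⟨i, hi⟩ := exists_emb_eq hj
      have := congrFun h (⟨_, Nat.lt_succ_of_le (card_filter_lt_le y)⟩ : Fin (T.card + 1))
      rw [← hi, ← mem_down, ← mem_down, this]
  · intro x hx
    have hx : ∀ j : Fin (T.card + 1), (P.restrict (gapOf T j)).IsCut (x j) := fun j =>
      mem_cutSets.1 (Fintype.mem_piFinset.1 hx j)
    set S : Finset (Fin P.deg) :=
      T ∪ Finset.univ.biUnion fun j : Fin (T.card + 1) => up (gapOf T j) (x j) with hSdef
    have hmem : ∀ y, y ∈ S ↔ y ∈ T ∨ ∃ j : Fin (T.card + 1), y ∈ up (gapOf T j) (x j) := by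
      intro y
      simp [hSdef]
    refine ⟨S, mem_cutsWith.2 ⟨mem_cutSets.2 ?_, Finset.subset_union_left⟩, ?_⟩
    · intro a b y hab hay hyb hy
      by_cases haT : a ∈ T
      · exact ⟨(hmem a).2 (.inl haT), (hmem b).2 (.inl (hT.mem_of_rel hab haT))⟩
      rcases (hmem y).1 hy with hy | ⟨j, hy⟩
      · exact absurd (hT a b y hab hay hyb hy).1 haT
      · obtain ⟨i, hi, rfl⟩ := mem_up.1 hy
        obtain ⟨ha, hb⟩ := hT.mem_gapOf_of_between (j := j) hab haT hay hyb
        obtain ⟨a, rfl⟩ := exists_emb_eq (ha.2 (emb_mem _ i))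
        obtain ⟨b, rfl⟩ := exists_emb_eq (hb.2 (emb_mem _ i))
        have := hx j a b i hab ((emb _).le_iff_le.1 hay) ((emb _).le_iff_le.1 hyb) hi
        exact ⟨(hmem _).2 (.inr ⟨j, emb_mem_up.2 this.1⟩),
          (hmem _).2 (.inr ⟨j, emb_mem_up.2 this.2⟩)⟩
    · funext j
      ext i
      have hi := mem_gapOf.1 (emb_mem (gapOf T j) i)
      rw [mem_down, hmem]
      constructor
      · rintro (h | ⟨j', h⟩)
        · exact absurd h hi.1
        · have hi' := mem_gapOf.1 (up_subset _ _ h)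
          obtain rfl : j = j' := Fin.ext (hi.2.symm.trans hi'.2)
          exact emb_mem_up.1 h
      · intro h
        exact .inr ⟨j, emb_mem_up.2 h⟩

end Glue

end NCP0

namespace NCP0

/-! ### Gluing coarsenings -/

theorem mem_coarsenings {P : NCP0} {Q : NCOf P.deg} :
    Q ∈ P.coarsenings ↔ ∀ a b, P.part.1 a b → Q.1 a b := by
  simp only [coarsenings, Finset.mem_filter, Finset.mem_univ, true_and]
  exact Iff.rfl

/-- The restriction of a partition `Q` of the underlying set of `P`, as a partition of the
underlying set of the restriction of `P`. -/
def restrictPart (P : NCP0) (Q : NCOf P.deg) (s : Finset (Fin P.deg)) :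
    NCOf (P.restrict s).deg :=
  ((NCP0.mk P.deg Q).restrict s).part

theorem restrictPart_rel {P : NCP0} {Q : NCOf P.deg} {s : Finset (Fin P.deg)}
    {i j : Fin s.card} : (P.restrictPart Q s).1 i j ↔ Q.1 (emb s i) (emb s j) := Iff.rfl

theorem restrictPart_mem_coarsenings {P : NCP0} {Q : NCOf P.deg} (hQ : Q ∈ P.coarsenings)
    (s : Finset (Fin P.deg)) : P.restrictPart Q s ∈ (P.restrict s).coarsenings :=
  mem_coarsenings.2 fun _ _ h => mem_coarsenings.1 hQ _ _ h

open Classical in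
/-- Coarsenings of `P` that refine a noncrossing partition with parts `s i`, the fibres of `f`,
amount to families of coarsenings of the restrictions of `P` to the `s i`. -/
theorem sum_piFinset_coarsenings {M ι : Type*} [AddCommMonoid M] [Fintype ι] [DecidableEq ι]
    {P : NCP0} (f : Fin P.deg → ι) (s : ι → Finset (Fin P.deg)) (hs : ∀ i y, y ∈ s i ↔ f y = i)
    (hf : ∀ a c b d, a < c → c < b → b < d → f a = f b → f c = f d → f a = f c)
    (hP : ∀ a b, P.part.1 a b → f a = f b)
    (G : ((i : ι) → NCOf (P.restrict (s i)).deg) → M) :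
    ∑ x ∈ Fintype.piFinset fun i => (P.restrict (s i)).coarsenings, G x
      = ∑ Q ∈ P.coarsenings with ∀ a b, Q.1 a b → f a = f b,
          G fun i => P.restrictPart Q (s i) := by
  symm
  refine Finset.sum_bij (fun Q _ i => P.restrictPart Q (s i)) ?_ ?_ ?_ fun _ _ => rfl
  · intro Q hQ
    exact Fintype.mem_piFinset.2 fun i =>
      restrictPart_mem_coarsenings (Finset.mem_filter.1 hQ).1 _
  · intro Q hQ Q' hQ' h
    have key : ∀ Q Q' : NCOf P.deg, (∀ a b, Q.1 a b → f a = f b) →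
        (fun i => P.restrictPart Q (s i)) = (fun i => P.restrictPart Q' (s i)) →
        ∀ a b, Q.1 a b → Q'.1 a b := by
      intro Q Q' hQ h a b hab
      obtain ⟨i, hi⟩ := exists_emb_eq ((hs (f a) a).2 rfl)
      obtain ⟨j, hj⟩ := exists_emb_eq ((hs (f a) b).2 (hQ a b hab).symm)
      have h1 : (P.restrictPart Q (s (f a))).1 i j := by
        rw [restrictPart_rel, hi, hj]
        exact hab
      have h2 : P.restrictPart Q (s (f a)) = P.restrictPart Q' (s (f a)) := congrFun h (f a)
      rw [h2, restrictPart_rel, hi, hj] at h1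
      exact h1
    refine Subtype.ext (Setoid.ext fun a b => ⟨?_, ?_⟩)
    · exact key Q Q' (Finset.mem_filter.1 hQ).2 h a b
    · exact key Q' Q (Finset.mem_filter.1 hQ').2 h.symm a b
  · intro x hx
    have hx : ∀ i, x i ∈ (P.restrict (s i)).coarsenings := Fintype.mem_piFinset.1 hx
    have hinj : ∀ {i : ι} {k k' : Fin (s i).card}, emb (s i) k = emb (s i) k' → k = k' :=
      fun h => (emb _).injective h
    -- the glued relation
    let r : Setoid (Fin P.deg) :=
      { r := fun a b => ∃ (i : ι) (k l : Fin (s i).card),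
          emb (s i) k = a ∧ emb (s i) l = b ∧ (x i).1 k l
        iseqv :=
          { refl := fun a => by
              obtain ⟨k, hk⟩ := exists_emb_eq ((hs (f a) a).2 rfl)
              exact ⟨f a, k, k, hk, hk, (x _).1.refl' k⟩
            symm := by
              rintro a b ⟨i, k, l, hk, hl, h⟩
              exact ⟨i, l, k, hl, hk, (x _).1.symm' h⟩
            trans := by
              rintro a b c ⟨i, k, l, hk, hl, h⟩ ⟨i', k', l', hk', hl', h'⟩
              have hi : f b = i := (hs _ _).1 (hl ▸ emb_mem _ _)
              have hi' : f b = i' := (hs _ _).1 (hk' ▸ emb_mem _ _)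
              obtain rfl : i = i' := hi.symm.trans hi'
              obtain rfl := hinj (hl.trans hk'.symm)
              exact ⟨i, k, l', hk, hl', (x _).1.trans' h h'⟩ } }
    have hrdef : ∀ a b, r a b ↔ ∃ (i : ι) (k l : Fin (s i).card),
          emb (s i) k = a ∧ emb (s i) l = b ∧ (x i).1 k l := fun _ _ => Iff.rfl
    have hrf : ∀ a b, r a b → f a = f b := by
      rintro a b ⟨i, k, l, hk, hl, -⟩
      rw [(hs i a).1 (hk ▸ emb_mem _ _), (hs i b).1 (hl ▸ emb_mem _ _)]
    have hremb : ∀ (i : ι) (k l : Fin (s i).card),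
        r (emb (s i) k) (emb (s i) l) ↔ (x i).1 k l := by
      intro i k l
      constructor
      · rintro ⟨i', k', l', hk, hl, h⟩
        have h1 := (hs i _).1 (emb_mem (s i) k)
        have h2 := (hs i' _).1 (emb_mem (s i') k')
        obtain rfl : i' = i := by rw [← h1, ← h2, hk]
        obtain rfl := hinj hk
        obtain rfl := hinj hl
        exact h
      · exact fun h => ⟨i, k, l, rfl, rfl, h⟩
    have hr : IsNoncrossing r := by
      intro a c b d hac hcb hbd hab hcd
      have hfac := hf a c b d hac hcb hbd (hrf _ _ hab) (hrf _ _ hcd)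
      have hfab := hrf _ _ hab
      have hfcd := hrf _ _ hcd
      obtain ⟨i, hia⟩ : ∃ i, f a = i := ⟨_, rfl⟩
      rw [hia] at hfac hfab
      obtain ⟨a, rfl⟩ := exists_emb_eq ((hs i a).2 hia)
      obtain ⟨b, rfl⟩ := exists_emb_eq ((hs i b).2 hfab.symm)
      obtain ⟨c, rfl⟩ := exists_emb_eq ((hs i c).2 hfac.symm)
      obtain ⟨d, rfl⟩ := exists_emb_eq ((hs i d).2 (hfac.trans hfcd).symm)
      rw [hremb] at *
      exact (x i).2 a c b d ((emb _).lt_iff_lt.1 hac) ((emb _).lt_iff_lt.1 hcb)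
        ((emb _).lt_iff_lt.1 hbd) hab hcd
    refine ⟨⟨r, hr⟩, Finset.mem_filter.2 ⟨mem_coarsenings.2 ?_, hrf⟩, ?_⟩
    · intro a b hab
      obtain ⟨k, hk⟩ := exists_emb_eq ((hs (f a) a).2 rfl)
      obtain ⟨l, hl⟩ := exists_emb_eq ((hs (f a) b).2 (hP a b hab).symm)
      refine ⟨f a, k, l, hk, hl, mem_coarsenings.1 (hx (f a)) k l ?_⟩
      exact (restrict_rel P _ k l).2 (by rw [hk, hl]; exact hab)
    · funext i
      exact Subtype.ext (Setoid.ext fun k l => hremb i k l)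

/-! ### The noncrossing partition attached to a cut -/

/-- The part containing `y` of the partition into `S` (labelled `0`) and its gaps (the `i`-th gap
is labelled `i + 1`). -/
def cutPart {n : ℕ} (S : Finset (Fin n)) (y : Fin n) : Fin (S.card + 2) :=
  if y ∈ S then 0 else Fin.succ ⟨(S.filter (· < y)).card, Nat.lt_succ_of_le (card_filter_lt_le y)⟩

/-- The parts of the partition into `S` and its gaps. -/
def cutParts {n : ℕ} (S : Finset (Fin n)) : Fin (S.card + 2) → Finset (Fin n) :=
  Fin.cons S fun i : Fin (S.card + 1) => gapOf S i

section CutPart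

variable {n : ℕ} {S : Finset (Fin n)}

theorem mem_cutParts (i : Fin (S.card + 2)) (y : Fin n) :
    y ∈ cutParts S i ↔ cutPart S y = i := by
  refine Fin.cases ?_ (fun i => ?_) i
  · rw [cutParts, Fin.cons_zero, cutPart]
    split_ifs with h
    · simp [h]
    · simp [h]
  · rw [cutParts, Fin.cons_succ, cutPart, mem_gapOf]
    split_ifs with h
    · simp [h, (Fin.succ_ne_zero i).symm]
    · simp [h, Fin.ext_iff]

theorem cutPart_eq_iff {a b : Fin n} (hab : a ≤ b) (ha : a ∉ S) :
    cutPart S a = cutPart S b ↔ ∀ x ∈ S, ¬ (a ≤ x ∧ x ≤ b) := by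
  by_cases hb : b ∈ S
  · simp only [cutPart, ha, hb, if_true, if_false]
    exact iff_of_false (Fin.succ_ne_zero _) fun h => h b hb ⟨hab, le_rfl⟩
  · rw [← card_filter_lt_eq_iff hb hab]
    simp [cutPart, ha, hb, Fin.ext_iff]

theorem cutPart_eq_zero {a : Fin n} : cutPart S a = 0 ↔ a ∈ S := by
  rw [← mem_cutParts]
  rfl

theorem cutPart_noncrossing (a c b d : Fin n) (hac : a < c) (hcb : c < b) (hbd : b < d)
    (hab : cutPart S a = cutPart S b) (hcd : cutPart S c = cutPart S d) :
    cutPart S a = cutPart S c := by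
  by_cases ha : a ∈ S
  · have hb : b ∈ S := by rw [← cutPart_eq_zero] at ha ⊢; rw [← hab, ha]
    by_cases hc : c ∈ S
    · rw [cutPart_eq_zero.2 ha, cutPart_eq_zero.2 hc]
    · exact absurd ⟨hcb.le, hbd.le⟩ ((cutPart_eq_iff (hcb.trans hbd).le hc).1 hcd b hb)
  · refine (cutPart_eq_iff hac.le ha).2 fun x hx h => ?_
    exact (cutPart_eq_iff (hac.trans hcb).le ha).1 hab x hx ⟨h.1, h.2.trans hcb.le⟩

end CutPart

/-- `S` is a cut of `P` if and only if `P` refines the partition into `S` and its gaps. -/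
theorem isCut_iff {P : NCP0} {S : Finset (Fin P.deg)} :
    P.IsCut S ↔ ∀ a b, P.part.1 a b → cutPart S a = cutPart S b := by
  constructor
  · intro hS a b hab
    wlog h : a ≤ b generalizing a b
    · exact (this b a (P.part.1.symm' hab) (le_of_not_ge h)).symm
    by_cases ha : a ∈ S
    · rw [cutPart_eq_zero.2 ha, cutPart_eq_zero.2 (hS.mem_of_rel hab ha)]
    · exact (cutPart_eq_iff h ha).2 fun x hx hax => ha (hS a b x hab hax.1 hax.2 hx).1
  · intro h a b y hab hay hyb hy
    have := h a b hab
    by_cases ha : a ∈ S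
    · exact ⟨ha, cutPart_eq_zero.1 (this.symm.trans (cutPart_eq_zero.2 ha))⟩
    · exact absurd ⟨hay, hyb⟩ ((cutPart_eq_iff (hay.trans hyb) ha).1 this y hy)

end NCP0

/-! ### Fibres -/

open NCP0

section Fibre

variable {K : Type*} [Field K]

/-- The blocks of the restriction of `Q` to a union of blocks are blocks of `Q`. -/
theorem prod_blocks_restrict {Q : NCP0} {s : Finset (Fin Q.deg)}
    (hsat : ∀ a b, Q.part.1 a b → a ∈ s → b ∈ s) {M : Type*} [CommMonoid M]
    (F : Finset (Fin Q.deg) → M) :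
    ∏ τ ∈ (Q.restrict s).blocks, F (up s τ) = ∏ τ ∈ Q.blocks with τ ⊆ s, F τ := by
  refine Finset.prod_nbij' (fun τ => up s τ) (fun τ => down s τ) ?_ ?_ ?_ ?_ ?_
  · intro τ hτ
    obtain ⟨i, rfl⟩ := mem_blocks.1 hτ
    refine Finset.mem_filter.2 ⟨mem_blocks.2 ⟨emb s i, ?_⟩, up_subset _ _⟩
    refine ((up_eq_iff fun y hy => hsat _ _ (mem_blockOf.1 hy) (emb_mem s i)).2 fun j => ?_).symm
    have e : j ∈ (Q.restrict s).blockOf i ↔ Q.part.1 (emb s i) (emb s j) := mem_blockOf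
    exact e.trans mem_blockOf.symm
  · intro τ hτ
    obtain ⟨hτ, hsub⟩ := Finset.mem_filter.1 hτ
    obtain ⟨y, hy⟩ := block_nonempty hτ
    obtain ⟨i, rfl⟩ := exists_emb_eq (hsub hy)
    refine mem_blocks.2 ⟨i, ?_⟩
    ext j
    rw [eq_blockOf hτ hy]
    have e : j ∈ (Q.restrict s).blockOf i ↔ Q.part.1 (emb s i) (emb s j) := mem_blockOf
    exact e.trans (mem_blockOf.symm.trans mem_down.symm)
  · intro τ _
    exact down_up
  · intro τ hτ
    exact (up_down s τ).trans (Finset.inter_eq_left.2 (Finset.mem_filter.1 hτ).2)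
  · intro τ _
    rfl

/-- If `Q` refines a partition with parts `s i`, the fibre of `P` over `Q` is the product of the
fibres over its restrictions to the `s i`. -/
theorem fibre_eq_prod {ι : Type*} [Fintype ι] [DecidableEq ι] {P : NCP0} {Q : NCOf P.deg}
    (f : Fin P.deg → ι) (s : ι → Finset (Fin P.deg)) (hs : ∀ i y, y ∈ s i ↔ f y = i)
    (hQ : ∀ a b, Q.1 a b → f a = f b) :
    ∏ i, fibre (K := K) (P.restrict (s i)) (P.restrictPart Q (s i)) = fibre P Q := by
  have h1 : ∀ i, fibre (K := K) (P.restrict (s i)) (P.restrictPart Q (s i))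
      = ∏ τ ∈ (NCP0.mk P.deg Q).blocks with τ ⊆ s i, blgen (P.restrict τ) := by
    intro i
    rw [← prod_blocks_restrict (Q := NCP0.mk P.deg Q) (s := s i)
      (fun a b hab ha => (hs i b).2 (by rw [← hQ a b hab]; exact (hs i a).1 ha))]
    exact Finset.prod_congr rfl fun τ _ => congrArg blgen (restrict_restrict P (s i) τ)
  simp only [h1, Finset.prod_filter]
  rw [Finset.prod_comm]
  refine Finset.prod_congr rfl fun τ hτ => ?_
  obtain ⟨y, hy⟩ := block_nonempty hτ
  rw [Finset.prod_eq_single (f y), if_pos]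
  · intro z hz
    exact (hs _ _).2 (hQ _ _ (rel_of_mem_block hτ hz hy))
  · intro i _ hi
    rw [if_neg fun hsub => hi ((hs _ _).1 (hsub hy)).symm]
  · intro h
    exact absurd (Finset.mem_univ _) h

end Fibre

/-! ### Coalgebra axioms on algebra generators -/

section AlgHoms

variable {K : Type*} [Field K]

theorem prod_tmul_prod {R A B ι : Type*} [CommSemiring R] [CommSemiring A] [Algebra R A]
    [CommSemiring B] [Algebra R B] (s : Finset ι) (f : ι → A) (g : ι → B) :
    ∏ i ∈ s, (f i ⊗ₜ[R] g i) = (∏ i ∈ s, f i) ⊗ₜ[R] ∏ i ∈ s, g i := by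
  classical
  induction s using Finset.induction_on with
  | empty => simp [Algebra.TensorProduct.one_def]
  | insert a s ha ih => simp [Finset.prod_insert ha, ih]

variable {A B : Type*} [Ring A] [Algebra K A] [Ring B] [Algebra K B]

/-- The composite `(ρ ⊗ Id) ρ`, reassociated, as an algebra morphism. -/
def coassocLeft (ρ : A →ₐ[K] A ⊗[K] B) : A →ₐ[K] A ⊗[K] (B ⊗[K] B) :=
  (Algebra.TensorProduct.assoc K K K A B B).toAlgHom.comp
    ((Algebra.TensorProduct.map ρ (AlgHom.id K B)).comp ρ)

/-- The composite `(Id ⊗ δ) ρ`, as an algebra morphism. -/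
def coassocRight (ρ : A →ₐ[K] A ⊗[K] B) (δ : B →ₐ[K] B ⊗[K] B) : A →ₐ[K] A ⊗[K] (B ⊗[K] B) :=
  (Algebra.TensorProduct.map (AlgHom.id K A) δ).comp ρ

theorem coassocLeft_apply (ρ : A →ₐ[K] A ⊗[K] B) (x : A) :
    coassocLeft ρ x = TensorProduct.assoc K A B B (ρ.toLinearMap.rTensor B (ρ x)) := rfl

theorem coassocRight_apply (ρ : A →ₐ[K] A ⊗[K] B) (δ : B →ₐ[K] B ⊗[K] B) (x : A) :
    coassocRight ρ δ x = δ.toLinearMap.lTensor A (ρ x) := rfl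

theorem coassoc_of_algHom {ρ : A →ₐ[K] A ⊗[K] B} {δ : B →ₐ[K] B ⊗[K] B}
    (h : coassocLeft ρ = coassocRight ρ δ) :
    (TensorProduct.assoc K A B B).toLinearMap ∘ₗ ρ.toLinearMap.rTensor B ∘ₗ ρ.toLinearMap
      = δ.toLinearMap.lTensor A ∘ₗ ρ.toLinearMap :=
  LinearMap.ext fun x => DFunLike.congr_fun h x

theorem counit_right_of_algHom {ρ : A →ₐ[K] A ⊗[K] B} {ε : B →ₐ[K] K}
    (h : (Algebra.TensorProduct.map (AlgHom.id K A) ε).comp ρ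
      = Algebra.TensorProduct.includeLeft) :
    ε.toLinearMap.lTensor A ∘ₗ ρ.toLinearMap = (TensorProduct.mk K A K).flip 1 :=
  LinearMap.ext fun x => DFunLike.congr_fun h x

theorem counit_left_of_algHom {ρ : A →ₐ[K] A ⊗[K] A} {ε : A →ₐ[K] K}
    (h : (Algebra.TensorProduct.map ε (AlgHom.id K A)).comp ρ
      = Algebra.TensorProduct.includeRight) :
    ε.toLinearMap.rTensor A ∘ₗ ρ.toLinearMap = TensorProduct.mk K K A 1 :=
  LinearMap.ext fun x => DFunLike.congr_fun h x

theorem isBialg_of_algHom {Δ : A →ₐ[K] A ⊗[K] A} {ε : A →ₐ[K] K}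
    (h : coassocLeft Δ = coassocRight Δ Δ)
    (hl : (Algebra.TensorProduct.map ε (AlgHom.id K A)).comp Δ
      = Algebra.TensorProduct.includeRight)
    (hr : (Algebra.TensorProduct.map (AlgHom.id K A) ε).comp Δ
      = Algebra.TensorProduct.includeLeft) :
    IsBialg Δ.toLinearMap ε.toLinearMap where
  coassoc := coassoc_of_algHom h
  counit_left := counit_left_of_algHom hl
  counit_right := counit_right_of_algHom hr
  comul_one := map_one Δ
  comul_mul := map_mul Δ
  counit_one := map_one ε
  counit_mul := map_mul ε

end AlgHoms

/-! ### The block-substitution bialgebra -/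

section BlockSubstitution

variable {K : Type*} [Field K]

theorem blocks_eq_empty {P : NCP0} (hP : P.deg = 0) : P.blocks = ∅ :=
  Finset.eq_empty_of_forall_notMem fun τ hτ => by
    obtain ⟨i, -⟩ := mem_blocks.1 hτ
    exact absurd i.2 (by omega)

theorem fibre_of_deg_eq_zero {P : NCP0} (hP : P.deg = 0) (Q : NCOf P.deg) :
    fibre (K := K) P Q = 1 := by
  rw [fibre, blocks_eq_empty (P := NCP0.mk P.deg Q) hP, Finset.prod_empty]

theorem coarsenings_of_deg_eq_zero {P : NCP0} (hP : P.deg = 0) : P.coarsenings = {P.part} := by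
  ext Q
  rw [Finset.mem_singleton, mem_coarsenings]
  constructor
  · intro _
    exact Subtype.ext (Setoid.ext fun a => absurd a.2 (by omega))
  · rintro rfl a b h
    exact h

theorem blgen_of_deg_eq_zero {P : NCP0} (hP : P.deg = 0) : blgen (K := K) P = 1 := by
  simp [blgen, hP]

theorem hgen_of_deg_eq_zero {P : NCP0} (hP : P.deg = 0) : hgen (K := K) P = 1 := by
  simp [hgen, hP]

theorem blgen_coe (P : NCP) : blgen (K := K) P.1 = MvPolynomial.X P := by
  obtain ⟨P, hP⟩ := P
  simp [blgen, hP]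

theorem hgen_coe (P : NCP) : hgen (K := K) P.1 = FreeAlgebra.ι K P := by
  obtain ⟨P, hP⟩ := P
  simp [hgen, hP]

theorem comulBbl_blgen (P : NCP0) : comulBbl (K := K) (blgen (K := K) P)
    = ∑ Q ∈ P.coarsenings, blgen ⟨P.deg, Q⟩ ⊗ₜ[K] fibre P Q := by
  by_cases hP : P.deg = 0
  · rw [coarsenings_of_deg_eq_zero hP, Finset.sum_singleton, fibre_of_deg_eq_zero hP,
      blgen_of_deg_eq_zero hP, map_one]
    exact Algebra.TensorProduct.one_def
  · obtain ⟨P, rfl⟩ : ∃ P' : NCP, P'.1 = P := ⟨⟨P, hP⟩, rfl⟩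
    rw [blgen_coe, comulBbl, MvPolynomial.aeval_X]

theorem coactHgap_hgen (P : NCP0) : coactHgap (K := K) (hgen (K := K) P)
    = ∑ Q ∈ P.coarsenings, hgen ⟨P.deg, Q⟩ ⊗ₜ[K] fibre P Q := by
  by_cases hP : P.deg = 0
  · rw [coarsenings_of_deg_eq_zero hP, Finset.sum_singleton, fibre_of_deg_eq_zero hP,
      hgen_of_deg_eq_zero hP, map_one]
    exact Algebra.TensorProduct.one_def
  · obtain ⟨P, rfl⟩ : ∃ P' : NCP, P'.1 = P := ⟨⟨P, hP⟩, rfl⟩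
    rw [hgen_coe, coactHgap, FreeAlgebra.lift_ι_apply]

/-- The fibre over `R`, written as a product over any indexing of the blocks of `R`. -/
theorem fibre_eq_prod_parts {ι : Type*} [Fintype ι] [DecidableEq ι] {P : NCP0} {R : NCOf P.deg}
    (f : Fin P.deg → ι) (s : ι → Finset (Fin P.deg)) (hs : ∀ i y, y ∈ s i ↔ f y = i)
    (hsurj : Function.Surjective f) (hf : ∀ a b, f a = f b ↔ R.1 a b) :
    fibre (K := K) P R = ∏ i, blgen (P.restrict (s i)) := by
  have hblock : ∀ y, (NCP0.mk P.deg R).blockOf y = s (f y) := by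
    intro y
    ext z
    refine (mem_blockOf (P := NCP0.mk P.deg R)).trans (Iff.trans ?_ (hs _ _).symm)
    exact (hf y z).symm.trans eq_comm
  have himage : (NCP0.mk P.deg R).blocks = Finset.univ.image s := by
    ext τ
    rw [mem_blocks, Finset.mem_image]
    constructor
    · rintro ⟨y, rfl⟩
      exact ⟨f y, Finset.mem_univ _, (hblock y).symm⟩
    · rintro ⟨i, -, rfl⟩
      obtain ⟨y, rfl⟩ := hsurj i
      exact ⟨y, hblock y⟩
  rw [fibre, himage, Finset.prod_image]
  intro i _ i' _ h
  obtain ⟨y, rfl⟩ := hsurj i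
  have : y ∈ s (f y) := (hs _ _).2 rfl
  rw [h] at this
  exact (hs _ _).1 this

open Classical in
/-- Gluing: the coproduct of the product of the restrictions of `P` to the parts `s i` of a
partition coarser than `P` runs over the partitions in between. -/
theorem comulBbl_prod_parts {ι : Type*} [Fintype ι] {P : NCP0}
    (f : Fin P.deg → ι) (s : ι → Finset (Fin P.deg)) (hs : ∀ i y, y ∈ s i ↔ f y = i)
    (hf : ∀ a c b d, a < c → c < b → b < d → f a = f b → f c = f d → f a = f c)
    (hP : ∀ a b, P.part.1 a b → f a = f b) :
    comulBbl (K := K) (∏ i, blgen (P.restrict (s i)))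
      = ∑ Q ∈ P.coarsenings with ∀ a b, Q.1 a b → f a = f b,
          (∏ i, blgen ((NCP0.mk P.deg Q).restrict (s i))) ⊗ₜ[K] fibre P Q := by
  rw [map_prod, Finset.prod_congr rfl fun i _ => comulBbl_blgen (P.restrict (s i)),
    Finset.prod_univ_sum, sum_piFinset_coarsenings f s hs hf hP]
  refine Finset.sum_congr rfl fun Q hQ => ?_
  rw [prod_tmul_prod, fibre_eq_prod f s hs (Finset.mem_filter.1 hQ).2]
  rfl

open Classical in
/-- The coproduct of a fibre runs over the intermediate partitions. -/
theorem comulBbl_fibre {P : NCP0} {R : NCOf P.deg} (hR : R ∈ P.coarsenings) :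
    comulBbl (K := K) (fibre (K := K) P R)
      = ∑ Q ∈ P.coarsenings with ∀ a b, Q.1 a b → R.1 a b,
          fibre ⟨P.deg, Q⟩ R ⊗ₜ[K] fibre P Q := by
  obtain ⟨f, hsurj, hf⟩ : ∃ f : Fin P.deg → Quotient R.1, Function.Surjective f ∧
      ∀ a b, f a = f b ↔ R.1 a b :=
    ⟨Quotient.mk R.1, Quotient.mk_surjective, fun _ _ => Quotient.eq⟩
  obtain ⟨s, hs⟩ : ∃ s : Quotient R.1 → Finset (Fin P.deg), ∀ i y, y ∈ s i ↔ f y = i :=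
    ⟨fun i => Finset.univ.filter fun y => f y = i, by simp⟩
  rw [fibre_eq_prod_parts f s hs hsurj hf, comulBbl_prod_parts f s hs]
  · simp only [hf]
    refine Finset.sum_congr rfl fun Q _ => ?_
    rw [fibre_eq_prod_parts (P := ⟨P.deg, Q⟩) f s hs hsurj hf]
  · intro a c b d hac hcb hbd hab hcd
    rw [hf] at *
    exact R.2 a c b d hac hcb hbd hab hcd
  · intro a b h
    exact (hf a b).2 (mem_coarsenings.1 hR a b h)

open Classical in
theorem sum_coarsenings_comm {M : Type*} [AddCommMonoid M] (P : NCP0)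
    (g : NCOf P.deg → NCOf P.deg → M) :
    ∑ Q ∈ P.coarsenings, ∑ R ∈ (NCP0.mk P.deg Q).coarsenings, g Q R
      = ∑ R ∈ P.coarsenings, ∑ Q ∈ P.coarsenings with ∀ a b, Q.1 a b → R.1 a b, g Q R := by
  refine Finset.sum_comm' (s := P.coarsenings) (t := fun Q => (NCP0.mk P.deg Q).coarsenings)
    (t' := P.coarsenings)
    (s' := fun R => P.coarsenings.filter fun Q => ∀ a b, Q.1 a b → R.1 a b) ?_
  intro Q R
  have e : R ∈ (NCP0.mk P.deg Q).coarsenings ↔ ∀ a b, Q.1 a b → R.1 a b := mem_coarsenings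
  rw [e, Finset.mem_filter, mem_coarsenings, mem_coarsenings]
  exact ⟨fun h => ⟨⟨h.1, h.2⟩, fun a b hab => h.2 _ _ (h.1 _ _ hab)⟩, fun h => h.1⟩

theorem comulBbl_coassoc : coassocLeft (comulBbl (K := K)) = coassocRight comulBbl comulBbl := by
  refine MvPolynomial.algHom_ext fun P => ?_
  rw [coassocLeft_apply, coassocRight_apply, ← blgen_coe, comulBbl_blgen]
  simp only [map_sum, LinearMap.rTensor_tmul, LinearMap.lTensor_tmul, AlgHom.toLinearMap_apply,
    comulBbl_blgen, TensorProduct.sum_tmul, TensorProduct.assoc_tmul]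
  rw [sum_coarsenings_comm P.1 fun Q R =>
    blgen (K := K) ⟨P.1.deg, R⟩ ⊗ₜ[K] (fibre (K := K) ⟨P.1.deg, Q⟩ R ⊗ₜ[K] fibre (K := K) P.1 Q)]
  refine Finset.sum_congr rfl fun R hR => ?_
  rw [comulBbl_fibre hR, TensorProduct.tmul_sum]

theorem coactHgap_coassoc :
    coassocLeft (coactHgap (K := K)) = coassocRight coactHgap comulBbl := by
  refine FreeAlgebra.hom_ext (funext fun P => ?_)
  simp only [Function.comp_apply]
  rw [coassocLeft_apply, coassocRight_apply, ← hgen_coe, coactHgap_hgen]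
  simp only [map_sum, LinearMap.rTensor_tmul, LinearMap.lTensor_tmul, AlgHom.toLinearMap_apply,
    coactHgap_hgen, TensorProduct.sum_tmul, TensorProduct.assoc_tmul]
  rw [sum_coarsenings_comm P.1 fun Q R =>
    hgen (K := K) ⟨P.1.deg, R⟩ ⊗ₜ[K] (fibre (K := K) ⟨P.1.deg, Q⟩ R ⊗ₜ[K] fibre (K := K) P.1 Q)]
  refine Finset.sum_congr rfl fun R hR => ?_
  rw [comulBbl_fibre hR, TensorProduct.tmul_sum]

open Classical in
theorem counitBbl_blgen {P : NCP0} (hP : P.deg ≠ 0) :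
    counitBbl (K := K) (blgen (K := K) P) = if ∀ a b, P.part.1 a b then 1 else 0 := by
  obtain ⟨P, rfl⟩ : ∃ P' : NCP, P'.1 = P := ⟨⟨P, hP⟩, rfl⟩
  rw [blgen_coe, counitBbl, MvPolynomial.aeval_X]
  exact if_congr (card_blocks_eq_one hP) rfl rfl

open Classical in
/-- `P/Q` consists of one-block partitions only if `Q = P`. -/
theorem counitBbl_fibre {P : NCP0} {Q : NCOf P.deg} (hQ : Q ∈ P.coarsenings) :
    counitBbl (K := K) (fibre (K := K) P Q) = if Q = P.part then 1 else 0 := by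
  have hval : ∀ τ ∈ (NCP0.mk P.deg Q).blocks, counitBbl (K := K) (blgen (K := K) (P.restrict τ))
      = if ∀ a b : Fin τ.card, P.part.1 (emb τ a) (emb τ b) then 1 else 0 := fun τ hτ =>
    counitBbl_blgen (P := P.restrict τ) (Finset.card_ne_zero.2 (block_nonempty hτ))
  rw [fibre, map_prod, Finset.prod_congr rfl hval]
  split_ifs with h
  · subst h
    exact Finset.prod_eq_one fun τ hτ => if_pos fun a b =>
      rel_of_mem_block hτ (emb_mem _ _) (emb_mem _ _)
  · by_contra hne
    refine h (Subtype.ext (Setoid.ext fun a b => ⟨fun hab => ?_, mem_coarsenings.1 hQ a b⟩))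
    obtain ⟨i, hi⟩ := exists_emb_eq (self_mem_blockOf (P := NCP0.mk P.deg Q) a)
    obtain ⟨j, hj⟩ := exists_emb_eq ((mem_blockOf (P := NCP0.mk P.deg Q)).2 hab)
    have hτ := Finset.prod_ne_zero_iff.1 hne _ (blockOf_mem (P := NCP0.mk P.deg Q) a)
    have := (ite_ne_right_iff.1 hτ).1 i j
    rwa [hi, hj] at this

/-- The one-block partition of an `n`-element set. -/
def oneBlock (n : ℕ) : NCOf n := ⟨⊤, fun _ _ _ _ _ _ _ _ _ => trivial⟩

theorem oneBlock_mem_coarsenings (P : NCP0) : oneBlock P.deg ∈ P.coarsenings :=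
  mem_coarsenings.2 fun _ _ _ => trivial

theorem fibre_oneBlock {P : NCP0} (hP : P.deg ≠ 0) :
    fibre (K := K) P (oneBlock P.deg) = blgen P := by
  have : (NCP0.mk P.deg (oneBlock P.deg)).blocks = {Finset.univ} := by
    ext τ
    rw [Finset.mem_singleton, mem_blocks]
    have h : ∀ i, (NCP0.mk P.deg (oneBlock P.deg)).blockOf i = Finset.univ := fun i =>
      Finset.eq_univ_of_forall fun j => mem_blockOf.2 trivial
    constructor
    · rintro ⟨i, rfl⟩
      exact h i
    · rintro rfl
      exact ⟨⟨0, Nat.pos_of_ne_zero hP⟩, h _⟩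
  rw [fibre, this, Finset.prod_singleton, restrict_univ]

theorem sum_counitBbl_fibre {M : Type*} [AddCommMonoid M] [Module K M] (P : NCP0)
    (F : NCOf P.deg → M) :
    ∑ Q ∈ P.coarsenings, F Q ⊗ₜ[K] counitBbl (K := K) (fibre (K := K) P Q)
      = F P.part ⊗ₜ[K] (1 : K) := by
  classical
  rw [Finset.sum_eq_single P.part]
  · rw [counitBbl_fibre (mem_coarsenings.2 fun _ _ h => h), if_pos rfl]
  · intro Q hQ hne
    rw [counitBbl_fibre hQ, if_neg hne, TensorProduct.tmul_zero]
  · intro h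
    exact absurd (mem_coarsenings.2 fun _ _ h => h) h

theorem isBialg_Bbl : IsBialg (comulBbl (K := K)).toLinearMap counitBbl.toLinearMap := by
  classical
  refine isBialg_of_algHom comulBbl_coassoc ?_ ?_
  · refine MvPolynomial.algHom_ext fun P => ?_
    rw [← blgen_coe, AlgHom.comp_apply, comulBbl_blgen]
    simp only [map_sum, Algebra.TensorProduct.map_tmul, AlgHom.id_apply,
      Algebra.TensorProduct.includeRight_apply]
    rw [Finset.sum_eq_single (oneBlock P.1.deg)]
    · have h : counitBbl (K := K) (blgen ⟨P.1.deg, oneBlock P.1.deg⟩) = 1 :=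
        (counitBbl_blgen (P := ⟨P.1.deg, oneBlock P.1.deg⟩) P.2).trans (if_pos fun _ _ => trivial)
      rw [h, fibre_oneBlock P.2]
    · intro Q _ hne
      rw [counitBbl_blgen (P := ⟨P.1.deg, Q⟩) P.2, if_neg, TensorProduct.zero_tmul]
      exact fun h => hne (Subtype.ext (Setoid.ext fun a b => iff_of_true (h a b) trivial))
    · exact fun h => absurd (oneBlock_mem_coarsenings P.1) h
  · refine MvPolynomial.algHom_ext fun P => ?_
    rw [← blgen_coe, AlgHom.comp_apply, comulBbl_blgen]
    simp only [map_sum, Algebra.TensorProduct.map_tmul, AlgHom.id_apply]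
    exact sum_counitBbl_fibre P.1 fun Q => blgen ⟨P.1.deg, Q⟩

theorem isRightComodule_Hgap : IsRightComodule (comulBbl (K := K)).toLinearMap
    counitBbl.toLinearMap coactHgap.toLinearMap where
  coassoc := coassoc_of_algHom coactHgap_coassoc
  counit := counit_right_of_algHom (by
    refine FreeAlgebra.hom_ext (funext fun P => ?_)
    simp only [Function.comp_apply]
    rw [← hgen_coe, AlgHom.comp_apply, coactHgap_hgen]
    simp only [map_sum, Algebra.TensorProduct.map_tmul, AlgHom.id_apply]
    exact sum_counitBbl_fibre P.1 fun Q => hgen ⟨P.1.deg, Q⟩)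

end BlockSubstitution

/-! ### The coproduct and its halves on generators -/

theorem List.prod_ofFn_tmul {R A B : Type*} [CommSemiring R] [Semiring A] [Algebra R A]
    [Semiring B] [Algebra R B] {m : ℕ} (f : Fin m → A) (g : Fin m → B) :
    (List.ofFn fun i => f i ⊗ₜ[R] g i).prod = (List.ofFn f).prod ⊗ₜ[R] (List.ofFn g).prod := by
  induction m with
  | zero => simp [Algebra.TensorProduct.one_def]
  | succ m ih => simp [List.ofFn_succ, ih]

theorem List.prod_ofFn_sum (R : Type*) {A : Type*} [CommSemiring R] [Semiring A] [Algebra R A]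
    {m : ℕ} {α : Fin m → Type*} (s : ∀ i, Finset (α i)) (g : ∀ i, α i → A) :
    (List.ofFn fun i => ∑ x ∈ s i, g i x).prod
      = ∑ x ∈ Fintype.piFinset s, (List.ofFn fun i => g i (x i)).prod := by
  simpa only [MultilinearMap.mkPiAlgebraFin_apply] using
    (MultilinearMap.mkPiAlgebraFin R m A).map_sum_finset g s

section Generators

variable {K : Type*} [Field K]

/-- The reduced gap monomial `∏ i, P|D_i` for the gaps `D_i` of a set `S` of elements. -/
def gapProd (P : NCP0) (S : Finset (Fin P.deg)) : Hgap K :=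
  ((List.range (S.card + 1)).map fun i => hgen (P.restrict (gapOf S i))).prod

/-- The gaps of a cut depend only on the underlying set of its lower part. -/
theorem redGapMonomial_eq (P : NCP0) (L : Finset (Finset (Fin P.deg))) :
    redGapMonomial (K := K) P L = gapProd P (support L) := by
  rw [redGapMonomial, gapList, List.map_map]
  rfl

theorem gapProd_eq_ofFn (P : NCP0) (S : Finset (Fin P.deg)) :
    gapProd (K := K) P S
      = (List.ofFn fun j : Fin (S.card + 1) => hgen (P.restrict (gapOf S j))).prod := by
  rw [gapProd, ← list_ofFn_val]

theorem hgen_restrict_empty {P : NCP0} {s : Finset (Fin P.deg)} (hs : s = ∅) :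
    hgen (K := K) (P.restrict s) = 1 :=
  hgen_of_deg_eq_zero (Finset.card_eq_zero.2 hs)

theorem gapOf_univ {n : ℕ} (i : ℕ) : gapOf (Finset.univ : Finset (Fin n)) i = ∅ :=
  Finset.eq_empty_of_forall_notMem fun _ hy => (mem_gapOf.1 hy).1 (Finset.mem_univ _)

theorem gapProd_univ (P : NCP0) : gapProd (K := K) P Finset.univ = 1 := by
  refine List.prod_eq_one fun x hx => ?_
  obtain ⟨i, -, rfl⟩ := List.mem_map.1 hx
  exact hgen_restrict_empty (gapOf_univ i)

theorem gapProd_empty (P : NCP0) : gapProd (K := K) P ∅ = hgen P := by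
  have h : gapOf (∅ : Finset (Fin P.deg)) 0 = Finset.univ :=
    Finset.eq_univ_of_forall fun y => mem_gapOf.2 ⟨by simp, by simp⟩
  simp [gapProd, h, restrict_univ]

theorem comulHgap_coe (P : NCP) : comulHgap (FreeAlgebra.ι K P)
    = ∑ S ∈ P.1.cutSets, hgen (P.1.restrict S) ⊗ₜ[K] gapProd P.1 S := by
  rw [comulHgap, FreeAlgebra.lift_ι_apply]
  simp only [redGapMonomial_eq]
  exact sum_cuts P.1 fun S => hgen (P.1.restrict S) ⊗ₜ[K] gapProd P.1 S

theorem comulHgap_hgen (P : NCP0) : comulHgap (hgen (K := K) P)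
    = ∑ S ∈ P.cutSets, hgen (P.restrict S) ⊗ₜ[K] gapProd P S := by
  by_cases hP : P.deg = 0
  · have hempty : ∀ S : Finset (Fin P.deg), S = Finset.univ := fun S =>
      Finset.eq_univ_of_forall fun y => absurd y.2 (by omega)
    have hcuts : P.cutSets = {Finset.univ} := by
      ext S
      rw [Finset.mem_singleton, mem_cutSets, hempty S]
      exact iff_of_true (IsCut.univ P) rfl
    rw [hcuts, Finset.sum_singleton, restrict_univ, gapProd_univ, hgen_of_deg_eq_zero hP, map_one]
    exact Algebra.TensorProduct.one_def
  · obtain ⟨P, rfl⟩ : ∃ P' : NCP, P'.1 = P := ⟨⟨P, hP⟩, rfl⟩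
    rw [hgen_coe, comulHgap_coe]

open Classical in
/-- The half of the coproduct of a generator that is selected by the condition `q` on whether the
first element lies in the lower part of the cut. -/
def halfGen (q : Prop → Prop) (P : NCP0) : Hgap K ⊗[K] Hgap K :=
  ∑ S ∈ P.cutsWith fun S => ∃ x : Fin P.deg, x.val = 0 ∧ q (x ∈ S),
    hgen (P.restrict S) ⊗ₜ[K] gapProd P S

open Classical in
/-- The cuts of a word are families of cuts of its letters, and a condition on the first element of
the word only concerns the cut of its first letter. -/
theorem sum_multiCuts (q : Prop → Prop) (P : NCP) (w : List NCP)
    (F : ((i : Fin (P :: w).length) → Finset (Finset (Fin ((P :: w).get i).1.deg))) → Prop)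
    [DecidablePred F] (hF : ∀ c, F c ↔ ∃ i : Fin (P :: w).length, i.val = 0 ∧
        ∃ x, x.val = 0 ∧ q (x ∈ support (c i))) :
    ∑ c ∈ (multiCuts (P :: w)).filter F, cutTerm (K := K) (P :: w) c
      = halfGen q P.1 * comulHgap (w.map (FreeAlgebra.ι K)).prod := by
  have hfilter : (multiCuts (P :: w)).filter F
      = Fintype.piFinset fun i : Fin (P :: w).length => ((P :: w).get i).1.cuts.filter fun L =>
          i.val = 0 → ∃ x, x.val = 0 ∧ q (x ∈ support L) := by
    ext c
    simp only [multiCuts, Finset.mem_filter, Fintype.mem_piFinset, hF]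
    constructor
    · rintro ⟨hc, i, hi, h⟩ j
      refine ⟨hc j, fun hj => ?_⟩
      obtain rfl : i = j := Fin.ext (hi.trans hj.symm)
      exact h
    · intro h
      exact ⟨fun i => (h i).1, ⟨0, Nat.succ_pos _⟩, rfl, (h ⟨0, Nat.succ_pos _⟩).2 rfl⟩
  rw [hfilter]
  simp only [cutTerm, ← List.prod_ofFn_tmul]
  refine (List.prod_ofFn_sum K _ fun (i : Fin (P :: w).length) L =>
    hgen (K := K) (((P :: w).get i).1.lower L) ⊗ₜ[K]
      redGapMonomial (K := K) ((P :: w).get i).1 L).symm.trans ?_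
  refine (congrArg List.prod (List.ofFn_succ (n := w.length))).trans ?_
  rw [List.prod_cons, map_list_prod, List.map_map]
  congr 1
  · simp only [redGapMonomial_eq, halfGen, sum_cutsWith, Finset.sum_filter]
    refine Eq.trans ?_ (sum_cuts P.1 fun S => if ∃ x : Fin P.1.deg, x.val = 0 ∧ q (x ∈ S) then
      hgen (K := K) (P.1.restrict S) ⊗ₜ[K] gapProd (K := K) P.1 S else 0)
    refine Finset.sum_congr rfl fun L _ => ?_
    refine if_congr ⟨fun h => h rfl, fun h _ => h⟩ rfl rfl
  · congr 1
    refine List.ext_getElem (by simp) fun i h1 h2 => ?_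
    simp only [List.getElem_ofFn, List.getElem_map, Function.comp_apply]
    refine Eq.trans ?_ (FreeAlgebra.lift_ι_apply _ _).symm
    refine Finset.sum_congr (Finset.filter_true_of_mem fun L _ h => ?_) fun _ _ => rfl
    exact absurd h (Nat.succ_ne_zero _)

theorem basisFreeMonoid_apply (w : FreeMonoid NCP) :
    FreeAlgebra.basisFreeMonoid K NCP w = (w.toList.map (FreeAlgebra.ι K)).prod := by
  have h : FreeAlgebra.basisFreeMonoid K NCP w
      = FreeAlgebra.equivMonoidAlgebraFreeMonoid.symm (MonoidAlgebra.single w 1) := rfl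
  rw [h]
  simp [FreeAlgebra.equivMonoidAlgebraFreeMonoid, FreeMonoid.lift_apply]

open Classical in
theorem precHgap_hgen_mul {P : NCP0} (hP : P.deg ≠ 0) (y : Hgap K) :
    precHgap (hgen P * y) = halfGen (fun p => p) P * comulHgap y := by
  obtain ⟨P, rfl⟩ : ∃ P' : NCP, P'.1 = P := ⟨⟨P, hP⟩, rfl⟩
  have : precHgap (K := K) ∘ₗ LinearMap.mulLeft K (hgen P.1)
      = LinearMap.mulLeft K (halfGen (K := K) (fun p => p) P.1)
        ∘ₗ (comulHgap (K := K)).toLinearMap := by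
    refine (FreeAlgebra.basisFreeMonoid K NCP).ext fun w => ?_
    simp only [LinearMap.comp_apply, LinearMap.mulLeft_apply, AlgHom.toLinearMap_apply]
    have hw : hgen (K := K) P.1 * FreeAlgebra.basisFreeMonoid K NCP w
        = FreeAlgebra.basisFreeMonoid K NCP (FreeMonoid.of P * w) := by
      rw [basisFreeMonoid_apply, basisFreeMonoid_apply, FreeMonoid.toList_of_mul, List.map_cons,
        List.prod_cons, hgen_coe]
    unfold precHgap
    rw [hw, Module.Basis.constr_basis, basisFreeMonoid_apply]
    exact sum_multiCuts (K := K) (fun p => p) P w.toList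
      (FirstInLower (P :: w.toList)) fun _ => Iff.rfl
  exact LinearMap.congr_fun this y

open Classical in
theorem succHgap_hgen_mul {P : NCP0} (hP : P.deg ≠ 0) (y : Hgap K) :
    succHgap (hgen P * y) = halfGen (fun p => ¬ p) P * comulHgap y := by
  obtain ⟨P, rfl⟩ : ∃ P' : NCP, P'.1 = P := ⟨⟨P, hP⟩, rfl⟩
  have : succHgap (K := K) ∘ₗ LinearMap.mulLeft K (hgen P.1)
      = LinearMap.mulLeft K (halfGen (K := K) (fun p => ¬ p) P.1)
        ∘ₗ (comulHgap (K := K)).toLinearMap := by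
    refine (FreeAlgebra.basisFreeMonoid K NCP).ext fun w => ?_
    simp only [LinearMap.comp_apply, LinearMap.mulLeft_apply, AlgHom.toLinearMap_apply]
    have hw : hgen (K := K) P.1 * FreeAlgebra.basisFreeMonoid K NCP w
        = FreeAlgebra.basisFreeMonoid K NCP (FreeMonoid.of P * w) := by
      rw [basisFreeMonoid_apply, basisFreeMonoid_apply, FreeMonoid.toList_of_mul, List.map_cons,
        List.prod_cons, hgen_coe]
    unfold succHgap
    rw [hw, Module.Basis.constr_basis, basisFreeMonoid_apply]
    exact sum_multiCuts (K := K) (fun p => ¬ p) P w.toList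
      (FirstInUpper (P :: w.toList)) fun _ => Iff.rfl
  exact LinearMap.congr_fun this y

end Generators

/-! ### Iterated cuts -/

section IteratedCuts

variable {K : Type*} [Field K]

/-- The monomial of the restrictions of `P` to `S ∩ D_j`, for the gaps `D_j` of `T`. For cuts
`T ⊆ S` this is the middle part of the iterated cut. -/
def midProd (P : NCP0) (T S : Finset (Fin P.deg)) : Hgap K :=
  ((List.range (T.card + 1)).map fun j => hgen (P.restrict (S ∩ gapOf T j))).prod

/-- The gaps of a cut of `P|S` are the intersections of `S` with gaps of `P`. -/
theorem gapProd_restrict (P : NCP0) (S : Finset (Fin P.deg)) (T : Finset (Fin S.card)) :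
    gapProd (K := K) (P.restrict S) T = midProd P (up S T) S := by
  rw [gapProd, midProd, card_up]
  congr 2
  funext i
  exact congrArg hgen ((restrict_restrict P S (gapOf T i)).trans
    (congrArg P.restrict (up_gapOf T i)))

theorem prod_hgen_down (P : NCP0) (T S : Finset (Fin P.deg)) :
    (List.ofFn fun j : Fin (T.card + 1) =>
      hgen (K := K) ((P.restrict (gapOf T j)).restrict (down (gapOf T j) S))).prod
      = midProd P T S := by
  rw [midProd, ← list_ofFn_val]
  congr 2
  funext j
  exact congrArg hgen ((restrict_restrict P _ _).trans (congrArg P.restrict (up_down _ _)))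

/-- The gaps of `S ⊇ T` are obtained by listing, for each gap of `T`, the gaps of `S` inside it. -/
theorem prod_gapProd_down (P : NCP0) {T S : Finset (Fin P.deg)} (hTS : T ⊆ S) :
    (List.ofFn fun j : Fin (T.card + 1) =>
      gapProd (K := K) (P.restrict (gapOf T j)) (down (gapOf T j) S)).prod = gapProd P S := by
  have h : ∀ j, gapProd (K := K) (P.restrict (gapOf T j)) (down (gapOf T j) S)
      = ((List.range ((S ∩ gapOf T j).card + 1)).map fun i =>
        hgen (P.restrict (gapOf S
          ((∑ l ∈ Finset.range j, ((S ∩ gapOf T l).card + 1)) + i)))).prod := by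
    intro j
    have hc : (down (gapOf T j) S).card = (S ∩ gapOf T j).card := by rw [← up_down, card_up]
    rw [gapProd, hc]
    congr 1
    refine List.map_congr_left fun i hi => ?_
    rw [restrict_restrict, up_gapOf, up_down,
      gapOf_inter_gapOf hTS (Nat.lt_succ_iff.1 (List.mem_range.1 hi))]
  rw [gapProd, card_eq_sum_gapOf hTS, ← prod_range_map_add, ← list_ofFn_val]
  simp only [h]

open Classical in
/-- The cuts of the gap monomial of a cut `T` are the cuts that contain `T`. -/
theorem prod_ofFn_sum_cutSets {P : NCP0} {T : Finset (Fin P.deg)} (hT : P.IsCut T)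
    (A : (j : Fin (T.card + 1)) → Finset (Finset (Fin (gapOf T j).card)))
    (ψ : (j : Fin (T.card + 1)) → Finset (Fin (gapOf T j).card) → Prop)
    (hA : ∀ j x, x ∈ A j ↔ x ∈ (P.restrict (gapOf T j)).cutSets ∧ ψ j x) :
    (List.ofFn fun j : Fin (T.card + 1) => ∑ x ∈ A j,
      hgen (K := K) ((P.restrict (gapOf T j)).restrict x) ⊗ₜ[K]
        gapProd (K := K) (P.restrict (gapOf T j)) x).prod
      = ∑ S ∈ P.cutsWith fun S => T ⊆ S ∧ ∀ j, ψ j (down (gapOf T j) S),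
          midProd (K := K) P T S ⊗ₜ[K] gapProd (K := K) P S := by
  rw [List.prod_ofFn_sum K]
  have hpi : Fintype.piFinset A
      = (Fintype.piFinset fun j : Fin (T.card + 1) => (P.restrict (gapOf T j)).cutSets).filter
        fun x => ∀ j, ψ j (x j) := by
    ext x
    rw [Finset.mem_filter, Fintype.mem_piFinset, Fintype.mem_piFinset, ← forall_and]
    exact forall_congr' fun j => hA j (x j)
  rw [hpi, Finset.sum_filter, sum_piFinset_cutSets hT]
  refine (sum_cutsWith_and _).trans ?_
  refine Finset.sum_congr rfl fun S hS => ?_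
  rw [List.prod_ofFn_tmul, prod_gapProd_down P (mem_cutsWith.1 hS).2.1, prod_hgen_down]

theorem comulHgap_gapProd_eq_ofFn (P : NCP0) (T : Finset (Fin P.deg)) :
    comulHgap (gapProd (K := K) P T)
      = (List.ofFn fun j : Fin (T.card + 1) => ∑ x ∈ (P.restrict (gapOf T j)).cutSets,
          hgen (K := K) ((P.restrict (gapOf T j)).restrict x) ⊗ₜ[K]
            gapProd (K := K) (P.restrict (gapOf T j)) x).prod := by
  rw [gapProd_eq_ofFn, map_list_prod, List.map_ofFn]
  congr 2
  funext j
  exact comulHgap_hgen _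

theorem comulHgap_gapProd {P : NCP0} {T : Finset (Fin P.deg)} (hT : P.IsCut T) :
    comulHgap (gapProd (K := K) P T)
      = ∑ S ∈ P.cutsWith fun S => T ⊆ S, midProd (K := K) P T S ⊗ₜ[K] gapProd (K := K) P S := by
  rw [comulHgap_gapProd_eq_ofFn]
  have := prod_ofFn_sum_cutSets (K := K) hT (fun j => (P.restrict (gapOf T j)).cutSets)
    (fun _ _ => True) fun j x => (iff_of_eq (and_true _)).symm
  simpa only [implies_true, and_true] using this

/-- The cuts of the lower part of a cut `S` are the cuts contained in `S`. -/
theorem comulHgap_hgen_restrict {P : NCP0} {S : Finset (Fin P.deg)} (hS : P.IsCut S) :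
    comulHgap (hgen (K := K) (P.restrict S))
      = ∑ T ∈ P.cutsWith fun T => T ⊆ S, hgen (K := K) (P.restrict T) ⊗ₜ[K] midProd P T S := by
  rw [comulHgap_hgen, ← sum_cutSets_restrict hS fun T =>
    hgen (K := K) (P.restrict T) ⊗ₜ[K] midProd (K := K) P T S]
  refine Finset.sum_congr rfl fun T _ => ?_
  rw [gapProd_restrict]
  exact congrArg (fun x => hgen x ⊗ₜ[K] midProd P (up S T) S) (restrict_restrict P S T)

theorem emb_zero {n : ℕ} {s : Finset (Fin n)} {z : Fin n} (hz : z.val = 0) (hzs : z ∈ s)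
    {x : Fin s.card} (hx : x.val = 0) : emb s x = z := by
  obtain ⟨i, hi⟩ := exists_emb_eq hzs
  have hxi : x ≤ i := Fin.le_def.2 (by omega)
  have h := (emb s).le_iff_le.2 hxi
  rw [hi] at h
  exact Fin.ext (by have := Fin.le_def.1 h; omega)

theorem exists_first_iff {n : ℕ} {s : Finset (Fin n)} {z : Fin n} (hz : z.val = 0) (hzs : z ∈ s)
    (q : Prop → Prop) (T : Finset (Fin s.card)) :
    (∃ x : Fin s.card, x.val = 0 ∧ q (x ∈ T)) ↔ q (z ∈ up s T) := by
  constructor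
  · rintro ⟨x, hx, h⟩
    rwa [← emb_zero hz hzs hx, emb_mem_up]
  · intro h
    have hs : 0 < s.card := Finset.card_pos.2 ⟨z, hzs⟩
    refine ⟨⟨0, hs⟩, rfl, ?_⟩
    rwa [← emb_zero hz hzs (x := ⟨0, hs⟩) rfl, emb_mem_up] at h

theorem halfGen_eq (q : Prop → Prop) {P : NCP0} {z : Fin P.deg} (hz : z.val = 0) :
    halfGen (K := K) q P = ∑ S ∈ P.cutsWith fun S => q (z ∈ S),
      hgen (P.restrict S) ⊗ₜ[K] gapProd P S := by
  rw [halfGen]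
  refine Finset.sum_congr (cutsWith_congr fun S _ => ?_) fun _ _ => rfl
  constructor
  · rintro ⟨x, hx, h⟩
    obtain rfl : x = z := Fin.ext (hx.trans hz.symm)
    exact h
  · exact fun h => ⟨z, hz, h⟩

open Classical in
theorem halfGen_restrict (q : Prop → Prop) {P : NCP0} {z : Fin P.deg} (hz : z.val = 0)
    {S : Finset (Fin P.deg)} (hS : P.IsCut S) (hzS : z ∈ S) :
    halfGen (K := K) q (P.restrict S)
      = ∑ T ∈ P.cutsWith fun T => T ⊆ S ∧ q (z ∈ T),
          hgen (K := K) (P.restrict T) ⊗ₜ[K] midProd P T S := by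
  rw [← sum_cutsWith_and, ← sum_cutSets_restrict hS fun T =>
    if q (z ∈ T) then hgen (K := K) (P.restrict T) ⊗ₜ[K] midProd (K := K) P T S else 0,
    halfGen, sum_cutsWith]
  refine Finset.sum_congr rfl fun T _ => ?_
  refine if_congr (exists_first_iff hz hzS q T) ?_ rfl
  rw [gapProd_restrict]
  exact congrArg (fun x => hgen x ⊗ₜ[K] midProd P (up S T) S) (restrict_restrict P S T)

/-- `D` is a half-coproduct: `D(xy) = D(x) Δ(y)`, and on generators it is the part of the
coproduct selected by the condition `q` on whether the first element is in the lower part. -/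
def IsHalf (q : Prop → Prop) (D : Hgap K →ₗ[K] Hgap K ⊗[K] Hgap K) : Prop :=
  ∀ P : NCP0, P.deg ≠ 0 → ∀ y, D (hgen P * y) = halfGen q P * comulHgap y

theorem IsHalf.hgen {q : Prop → Prop} {D : Hgap K →ₗ[K] Hgap K ⊗[K] Hgap K} (hD : IsHalf q D)
    {P : NCP0} (hP : P.deg ≠ 0) : D (hgen P) = halfGen q P := by
  have := hD P hP 1
  rwa [mul_one, map_one, mul_one] at this

theorem mem_gapOf_zero {n : ℕ} {T : Finset (Fin n)} {z : Fin n} (hz : z.val = 0) (hzT : z ∉ T) :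
    z ∈ gapOf T 0 := by
  refine mem_gapOf.2 ⟨hzT, Finset.card_eq_zero.2 (Finset.filter_eq_empty_iff.2 fun x _ h => ?_)⟩
  have := Fin.lt_def.1 h
  omega

/-- A half-coproduct of the gap monomial of a cut `T` that does not contain the first element `z`
runs over the cuts that contain `T`, selected by the condition on `z`: the element `z` is the first
element of the first gap. -/
theorem IsHalf.gapProd {q : Prop → Prop} {D : Hgap K →ₗ[K] Hgap K ⊗[K] Hgap K} (hD : IsHalf q D)
    {P : NCP0} {z : Fin P.deg} (hz : z.val = 0) {T : Finset (Fin P.deg)} (hT : P.IsCut T)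
    (hzT : z ∉ T) :
    D (gapProd P T) = ∑ S ∈ P.cutsWith fun S => T ⊆ S ∧ q (z ∈ S),
      midProd (K := K) P T S ⊗ₜ[K] gapProd (K := K) P S := by
  have hz0 : z ∈ gapOf T 0 := mem_gapOf_zero hz hzT
  have hdeg : (P.restrict (gapOf T 0)).deg ≠ 0 := Finset.card_ne_zero.2 ⟨z, hz0⟩
  have key := prod_ofFn_sum_cutSets (K := K) hT
    (Fin.cases ((P.restrict (gapOf T 0)).cutsWith fun x =>
      ∃ x0 : Fin (gapOf T 0).card, x0.val = 0 ∧ q (x0 ∈ x))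
      fun j => (P.restrict (gapOf T j.succ)).cutSets)
    (Fin.cases (fun x => ∃ x0 : Fin (gapOf T 0).card, x0.val = 0 ∧ q (x0 ∈ x)) fun _ _ => True)
    (Fin.cases (fun x => mem_cutsWith) fun j x => (iff_of_eq (and_true _)).symm)
  have hcond : ∀ S : Finset (Fin P.deg), (∀ j : Fin (T.card + 1),
      Fin.cases (motive := fun j => Finset (Fin (gapOf T j).card) → Prop)
        (fun x => ∃ x0 : Fin (gapOf T 0).card, x0.val = 0 ∧ q (x0 ∈ x)) (fun _ _ => True) j
        (down (gapOf T j) S)) ↔ q (z ∈ S) := by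
    intro S
    rw [Fin.forall_fin_succ]
    refine (and_iff_left fun _ => trivial).trans ?_
    refine (exists_first_iff hz hz0 q (down (gapOf T 0) S)).trans ?_
    rw [up_down, Finset.mem_inter, and_iff_left hz0]
  simp only [hcond] at key
  rw [← key, gapProd_eq_ofFn, List.ofFn_succ, List.ofFn_succ, List.prod_cons, List.prod_cons]
  refine (hD _ hdeg _).trans ?_
  congr 1
  rw [map_list_prod, List.map_ofFn]
  congr 2
  funext j
  exact comulHgap_hgen _

theorem sum_cutSets_comm {M : Type*} [AddCommMonoid M] (P : NCP0)
    (A B : Finset (Fin P.deg) → Prop) (g : Finset (Fin P.deg) → Finset (Fin P.deg) → M) :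
    ∑ S ∈ P.cutsWith fun S => A S, ∑ T ∈ P.cutsWith fun T => T ⊆ S ∧ B T, g T S
      = ∑ T ∈ P.cutsWith fun T => B T, ∑ S ∈ P.cutsWith fun S => T ⊆ S ∧ A S, g T S := by
  refine Finset.sum_comm' fun S T => ?_
  simp only [mem_cutsWith]
  tauto

end IteratedCuts

/-! ### Codendriform relations -/

section TensorMul

variable {K A B ι : Type*} [Field K] [Ring A] [Algebra K A] [Ring B] [Algebra K B]

theorem rTensor_sum_tmul_mul (D Δ : A →ₗ[K] A ⊗[K] A) (s : Finset ι) (a : ι → A)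
    (b : ι → B) (h : ∀ i ∈ s, ∀ c, D (a i * c) = D (a i) * Δ c) (v : A ⊗[K] B) :
    D.rTensor B ((∑ i ∈ s, a i ⊗ₜ[K] b i) * v)
      = D.rTensor B (∑ i ∈ s, a i ⊗ₜ[K] b i) * Δ.rTensor B v := by
  rw [Finset.sum_mul, map_sum, map_sum, Finset.sum_mul]
  refine Finset.sum_congr rfl fun i hi => ?_
  induction v using TensorProduct.induction_on with
  | zero => simp
  | tmul c d => simp [h i hi]
  | add v w hv hw => simp only [mul_add, map_add, hv, hw]

theorem lTensor_sum_tmul_mul (D Δ : A →ₗ[K] A ⊗[K] A) (s : Finset ι) (a : ι → B)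
    (b : ι → A) (h : ∀ i ∈ s, ∀ c, D (b i * c) = D (b i) * Δ c) (v : B ⊗[K] A) :
    D.lTensor B ((∑ i ∈ s, a i ⊗ₜ[K] b i) * v)
      = D.lTensor B (∑ i ∈ s, a i ⊗ₜ[K] b i) * Δ.lTensor B v := by
  rw [Finset.sum_mul, map_sum, map_sum, Finset.sum_mul]
  refine Finset.sum_congr rfl fun i hi => ?_
  induction v using TensorProduct.induction_on with
  | zero => simp
  | tmul c d => simp [h i hi]
  | add v w hv hw => simp only [mul_add, map_add, hv, hw]

end TensorMul

section Codendriform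

variable {K : Type*} [Field K]

open Classical in
theorem counitHgap_hgen (P : NCP0) :
    counitHgap (hgen (K := K) P) = if P.deg = 0 then 1 else 0 := by
  split_ifs with hP
  · rw [hgen_of_deg_eq_zero hP, map_one]
  · obtain ⟨P, rfl⟩ : ∃ P' : NCP, P'.1 = P := ⟨⟨P, hP⟩, rfl⟩
    rw [hgen_coe, counitHgap, FreeAlgebra.lift_ι_apply]

theorem counitHgap_hgen_of_deg_ne_zero {P : NCP0} (hP : P.deg ≠ 0) :
    counitHgap (hgen (K := K) P) = 0 := by
  classical
  rw [counitHgap_hgen, if_neg hP]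

theorem counitHgap_gapProd_of_mem {P : NCP0} {S : Finset (Fin P.deg)} {y : Fin P.deg}
    (hy : y ∉ S) : counitHgap (gapProd (K := K) P S) = 0 := by
  rw [gapProd, map_list_prod, List.prod_eq_zero_iff, List.map_map]
  refine List.mem_map.2 ⟨(S.filter (· < y)).card, ?_, ?_⟩
  · exact List.mem_range.2 (Nat.lt_succ_of_le (card_filter_lt_le y))
  · exact counitHgap_hgen_of_deg_ne_zero (Finset.card_ne_zero.2 ⟨y, mem_gapOf.2 ⟨hy, rfl⟩⟩)

/-- The augmentation ideal is generated, as a right ideal, by the nonempty partitions. -/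
theorem ker_counitHgap_le {N : Submodule K (Hgap K)}
    (hN : ∀ P : NCP0, P.deg ≠ 0 → ∀ y, hgen P * y ∈ N) :
    LinearMap.ker (counitHgap (K := K)).toLinearMap ≤ N := by
  let M : Submodule K (Hgap K) := Submodule.span K {x | ∃ (P : NCP) (y : Hgap K), x = hgen P.1 * y}
  have hMN : M ≤ N := Submodule.span_le.2 (by rintro _ ⟨P, y, rfl⟩; exact hN P.1 P.2 y)
  have hmul : ∀ x ∈ M, ∀ z, x * z ∈ M := by
    intro x hx z
    induction hx using Submodule.span_induction with
    | mem x hx =>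
      obtain ⟨P, y, rfl⟩ := hx
      exact Submodule.subset_span ⟨P, y * z, mul_assoc _ _ _⟩
    | zero => simp
    | add a b _ _ ha hb => rw [add_mul]; exact M.add_mem ha hb
    | smul c a _ ha => rw [smul_mul_assoc]; exact M.smul_mem c ha
  have key : ∀ x, x - algebraMap K (Hgap K) (counitHgap x) ∈ M := by
    intro x
    induction x using FreeAlgebra.induction with
    | grade0 r => simp
    | grade1 P =>
      rw [← hgen_coe, counitHgap_hgen_of_deg_ne_zero P.2, map_zero, sub_zero]
      exact Submodule.subset_span ⟨P, 1, (mul_one _).symm⟩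
    | mul a b ha hb =>
      have : a * b - algebraMap K (Hgap K) (counitHgap (a * b))
          = (a - algebraMap K (Hgap K) (counitHgap a)) * b
            + counitHgap a • (b - algebraMap K (Hgap K) (counitHgap b)) := by
        rw [Algebra.smul_def, map_mul, map_mul]
        noncomm_ring
      rw [this]
      exact M.add_mem (hmul _ ha _) (M.smul_mem _ hb)
    | add a b ha hb =>
      rw [map_add, map_add, add_sub_add_comm]
      exact M.add_mem ha hb
  intro x hx
  have := key x
  rw [show counitHgap x = 0 from hx, map_zero, sub_zero] at this
  exact hMN this

/-- Linear maps that agree on the products `P y` agree on the augmentation ideal. -/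
theorem eq_of_mem_ker {V : Type*} [AddCommGroup V] [Module K V] {f g : Hgap K →ₗ[K] V}
    (h : ∀ P : NCP0, P.deg ≠ 0 → ∀ y, f (hgen P * y) = g (hgen P * y)) {x : Hgap K}
    (hx : x ∈ LinearMap.ker (counitHgap (K := K)).toLinearMap) : f x = g x :=
  ker_counitHgap_le (N := LinearMap.eqLocus f g) h hx

theorem isHalf_prec : IsHalf (K := K) (fun p => p) precHgap := fun _ hP y =>
  precHgap_hgen_mul hP y

theorem isHalf_succ : IsHalf (K := K) (fun p => ¬ p) succHgap := fun _ hP y =>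
  succHgap_hgen_mul hP y

theorem IsHalf.mul {q : Prop → Prop} {D : Hgap K →ₗ[K] Hgap K ⊗[K] Hgap K} (hD : IsHalf q D)
    {x : Hgap K} (hx : x ∈ LinearMap.ker (counitHgap (K := K)).toLinearMap) (y : Hgap K) :
    D (x * y) = D x * comulHgap y := by
  refine eq_of_mem_ker (f := D ∘ₗ LinearMap.mulRight K y)
    (g := LinearMap.mulRight K (comulHgap y) ∘ₗ D) (fun P hP z => ?_) hx
  simp only [LinearMap.comp_apply, LinearMap.mulRight_apply]
  rw [mul_assoc, hD P hP, hD P hP, map_mul, mul_assoc]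

/-- The contribution of the nested cuts `T ⊆ S`. -/
def nestedTerm (P : NCP0) (T S : Finset (Fin P.deg)) : Hgap K ⊗[K] (Hgap K ⊗[K] Hgap K) :=
  hgen (P.restrict T) ⊗ₜ[K] (midProd P T S ⊗ₜ[K] gapProd P S)

section Generators

variable {P : NCP0} {z : Fin P.deg} (hz : z.val = 0)
include hz

theorem IsHalf.rTensor_halfGen {q : Prop → Prop} {D : Hgap K →ₗ[K] Hgap K ⊗[K] Hgap K}
    (hD : IsHalf q D) :
    TensorProduct.assoc K _ _ _ (D.rTensor (Hgap K) (halfGen (fun p => p) P))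
      = ∑ S ∈ P.cutsWith fun S => z ∈ S, ∑ T ∈ P.cutsWith fun T => T ⊆ S ∧ q (z ∈ T),
          nestedTerm P T S := by
  rw [halfGen_eq _ hz, map_sum, map_sum]
  refine Finset.sum_congr rfl fun S hS => ?_
  obtain ⟨hS, hzS⟩ := mem_cutsWith.1 hS
  rw [LinearMap.rTensor_tmul, hD.hgen (Finset.card_ne_zero.2 ⟨z, hzS⟩),
    halfGen_restrict q hz (mem_cutSets.1 hS) hzS, TensorProduct.sum_tmul, map_sum]
  rfl

theorem comul_rTensor_halfGen (r : Prop → Prop) :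
    TensorProduct.assoc K _ _ _
        ((comulHgap (K := K)).toLinearMap.rTensor (Hgap K) (halfGen r P))
      = ∑ S ∈ P.cutsWith fun S => r (z ∈ S), ∑ T ∈ P.cutsWith fun T => T ⊆ S, nestedTerm P T S := by
  rw [halfGen_eq _ hz, map_sum, map_sum]
  refine Finset.sum_congr rfl fun S hS => ?_
  rw [LinearMap.rTensor_tmul, AlgHom.toLinearMap_apply,
    comulHgap_hgen_restrict (mem_cutSets.1 (mem_cutsWith.1 hS).1), TensorProduct.sum_tmul,
    map_sum]
  rfl

theorem IsHalf.lTensor_halfGen {q : Prop → Prop} {D : Hgap K →ₗ[K] Hgap K ⊗[K] Hgap K}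
    (hD : IsHalf q D) :
    D.lTensor (Hgap K) (halfGen (fun p => ¬ p) P)
      = ∑ T ∈ P.cutsWith fun T => z ∉ T, ∑ S ∈ P.cutsWith fun S => T ⊆ S ∧ q (z ∈ S),
          nestedTerm P T S := by
  rw [halfGen_eq _ hz, map_sum]
  refine Finset.sum_congr rfl fun T hT => ?_
  obtain ⟨hT, hzT⟩ := mem_cutsWith.1 hT
  rw [LinearMap.lTensor_tmul, hD.gapProd hz (mem_cutSets.1 hT) hzT, TensorProduct.tmul_sum]
  rfl

theorem comul_lTensor_halfGen (r : Prop → Prop) :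
    (comulHgap (K := K)).toLinearMap.lTensor (Hgap K) (halfGen r P)
      = ∑ T ∈ P.cutsWith fun T => r (z ∈ T), ∑ S ∈ P.cutsWith fun S => T ⊆ S, nestedTerm P T S := by
  rw [halfGen_eq _ hz, map_sum]
  refine Finset.sum_congr rfl fun T hT => ?_
  rw [LinearMap.lTensor_tmul, AlgHom.toLinearMap_apply,
    comulHgap_gapProd (mem_cutSets.1 (mem_cutsWith.1 hT).1), TensorProduct.tmul_sum]
  rfl

theorem halfGen_true : halfGen (K := K) (fun _ => True) P = comulHgap (hgen P) := by
  rw [halfGen_eq _ hz, comulHgap_hgen]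
  exact Finset.sum_congr (cutsWith_true fun _ => trivial) fun _ _ => rfl

theorem halfGen_add : halfGen (K := K) (fun p => p) P + halfGen (fun p => ¬ p) P
    = comulHgap (hgen P) := by
  rw [halfGen_eq _ hz, halfGen_eq _ hz, comulHgap_hgen, sum_cutsWith_add_not]

theorem prec_prec_gen :
    TensorProduct.assoc K _ _ _ (precHgap.rTensor (Hgap K) (halfGen (K := K) (fun p => p) P))
      = (comulHgap (K := K)).toLinearMap.lTensor (Hgap K) (halfGen (fun p => p) P) := by
  classical
  rw [isHalf_prec.rTensor_halfGen hz, comul_lTensor_halfGen hz,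
    sum_cutSets_comm P (fun S => z ∈ S) (fun T => z ∈ T)]
  refine Finset.sum_congr rfl fun T hT => Finset.sum_congr ?_ fun _ _ => rfl
  exact cutsWith_congr fun S _ => and_iff_left_of_imp fun h => h (mem_cutsWith.1 hT).2

theorem succ_prec_gen :
    TensorProduct.assoc K _ _ _ (succHgap.rTensor (Hgap K) (halfGen (K := K) (fun p => p) P))
      = (precHgap (K := K)).lTensor (Hgap K) (halfGen (fun p => ¬ p) P) := by
  classical
  rw [isHalf_succ.rTensor_halfGen hz, isHalf_prec.lTensor_halfGen hz,
    sum_cutSets_comm P (fun S => z ∈ S) (fun T => z ∉ T)]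

theorem comul_succ_gen :
    TensorProduct.assoc K _ _ _
        ((comulHgap (K := K)).toLinearMap.rTensor (Hgap K) (halfGen (fun p => ¬ p) P))
      = (succHgap (K := K)).lTensor (Hgap K) (halfGen (fun p => ¬ p) P) := by
  classical
  rw [comul_rTensor_halfGen hz, isHalf_succ.lTensor_halfGen hz,
    ← sum_cutSets_comm P (fun S => z ∉ S) (fun T => z ∉ T)]
  refine Finset.sum_congr rfl fun S hS => Finset.sum_congr ?_ fun _ _ => rfl
  exact cutsWith_congr fun T _ =>
    (and_iff_left_of_imp fun h hzT => (mem_cutsWith.1 hS).2 (h hzT)).symm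

theorem comul_coassoc_gen :
    TensorProduct.assoc K _ _ _
        ((comulHgap (K := K)).toLinearMap.rTensor (Hgap K) (comulHgap (hgen P)))
      = (comulHgap (K := K)).toLinearMap.lTensor (Hgap K) (comulHgap (hgen P)) := by
  classical
  rw [← halfGen_true hz, comul_rTensor_halfGen hz, comul_lTensor_halfGen hz]
  have := sum_cutSets_comm P (fun _ => True) (fun _ => True) (nestedTerm (K := K) P)
  simpa only [and_true, cutsWith_true fun _ => trivial] using this

end Generators

theorem exists_first {P : NCP0} (hP : P.deg ≠ 0) : ∃ z : Fin P.deg, z.val = 0 :=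
  ⟨⟨0, Nat.pos_of_ne_zero hP⟩, rfl⟩

theorem comulHgap_coassoc :
    coassocLeft (comulHgap (K := K)) = coassocRight comulHgap comulHgap := by
  refine FreeAlgebra.hom_ext (funext fun P => ?_)
  simp only [Function.comp_apply]
  rw [coassocLeft_apply, coassocRight_apply, ← hgen_coe]
  obtain ⟨z, hz⟩ := exists_first P.2
  exact comul_coassoc_gen hz

theorem comulHgap_coassoc_apply (y : Hgap K) :
    TensorProduct.assoc K _ _ _ ((comulHgap (K := K)).toLinearMap.rTensor (Hgap K) (comulHgap y))
      = (comulHgap (K := K)).toLinearMap.lTensor (Hgap K) (comulHgap y) :=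
  DFunLike.congr_fun comulHgap_coassoc y

theorem assoc_mul (u v : (Hgap K ⊗[K] Hgap K) ⊗[K] Hgap K) :
    TensorProduct.assoc K (Hgap K) (Hgap K) (Hgap K) (u * v)
      = TensorProduct.assoc K (Hgap K) (Hgap K) (Hgap K) u
        * TensorProduct.assoc K (Hgap K) (Hgap K) (Hgap K) v :=
  map_mul (Algebra.TensorProduct.assoc K K K (Hgap K) (Hgap K) (Hgap K)) u v

theorem comul_lTensor_mul (u v : Hgap K ⊗[K] Hgap K) :
    (comulHgap (K := K)).toLinearMap.lTensor (Hgap K) (u * v)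
      = (comulHgap (K := K)).toLinearMap.lTensor (Hgap K) u
        * (comulHgap (K := K)).toLinearMap.lTensor (Hgap K) v :=
  map_mul (Algebra.TensorProduct.map (AlgHom.id K (Hgap K)) comulHgap) u v

theorem comul_rTensor_mul {B : Type*} [Ring B] [Algebra K B] (u v : Hgap K ⊗[K] B) :
    (comulHgap (K := K)).toLinearMap.rTensor B (u * v)
      = (comulHgap (K := K)).toLinearMap.rTensor B u
        * (comulHgap (K := K)).toLinearMap.rTensor B v :=
  map_mul (Algebra.TensorProduct.map comulHgap (AlgHom.id K B)) u v

/-- The lower parts in `Δ_≺(P)` are nonempty. -/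
theorem IsHalf.rTensor_halfGen_mul {q : Prop → Prop} {D : Hgap K →ₗ[K] Hgap K ⊗[K] Hgap K}
    (hD : IsHalf q D) {P : NCP0} (hP : P.deg ≠ 0) (v : Hgap K ⊗[K] Hgap K) :
    D.rTensor (Hgap K) (halfGen (fun p => p) P * v)
      = D.rTensor (Hgap K) (halfGen (fun p => p) P)
        * (comulHgap (K := K)).toLinearMap.rTensor (Hgap K) v := by
  classical
  obtain ⟨z, hz⟩ := exists_first hP
  rw [halfGen_eq _ hz]
  refine rTensor_sum_tmul_mul _ _ _ _ _ (fun S hS => hD.mul ?_) v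
  exact counitHgap_hgen_of_deg_ne_zero (Finset.card_ne_zero.2 ⟨z, (mem_cutsWith.1 hS).2⟩)

/-- The upper parts in `Δ_≻(P)` are nonempty. -/
theorem IsHalf.lTensor_halfGen_mul {q : Prop → Prop} {D : Hgap K →ₗ[K] Hgap K ⊗[K] Hgap K}
    (hD : IsHalf q D) {P : NCP0} (hP : P.deg ≠ 0) (v : Hgap K ⊗[K] Hgap K) :
    D.lTensor (Hgap K) (halfGen (fun p => ¬ p) P * v)
      = D.lTensor (Hgap K) (halfGen (fun p => ¬ p) P)
        * (comulHgap (K := K)).toLinearMap.lTensor (Hgap K) v := by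
  classical
  obtain ⟨z, hz⟩ := exists_first hP
  rw [halfGen_eq _ hz]
  refine lTensor_sum_tmul_mul _ _ _ _ _ (fun S hS => hD.mul ?_) v
  exact counitHgap_gapProd_of_mem (mem_cutsWith.1 hS).2

theorem prec_prec_Hgap {x : Hgap K} (hx : x ∈ LinearMap.ker (counitHgap (K := K)).toLinearMap) :
    TensorProduct.assoc K _ _ _ (precHgap.rTensor (Hgap K) (precHgap x))
      = (comulHgap (K := K)).toLinearMap.lTensor (Hgap K) (precHgap x) := by
  refine eq_of_mem_ker
    (f := (TensorProduct.assoc K _ _ _).toLinearMap ∘ₗ precHgap.rTensor (Hgap K) ∘ₗ precHgap)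
    (g := (comulHgap (K := K)).toLinearMap.lTensor (Hgap K) ∘ₗ precHgap) (fun P hP y => ?_) hx
  obtain ⟨z, hz⟩ := exists_first hP
  simp only [LinearMap.comp_apply, LinearEquiv.coe_coe]
  rw [isHalf_prec P hP, isHalf_prec.rTensor_halfGen_mul hP, assoc_mul, prec_prec_gen hz,
    comulHgap_coassoc_apply, comul_lTensor_mul]

theorem succ_prec_Hgap {x : Hgap K} (hx : x ∈ LinearMap.ker (counitHgap (K := K)).toLinearMap) :
    TensorProduct.assoc K _ _ _ (succHgap.rTensor (Hgap K) (precHgap x))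
      = (precHgap (K := K)).lTensor (Hgap K) (succHgap x) := by
  refine eq_of_mem_ker
    (f := (TensorProduct.assoc K _ _ _).toLinearMap ∘ₗ succHgap.rTensor (Hgap K) ∘ₗ precHgap)
    (g := (precHgap (K := K)).lTensor (Hgap K) ∘ₗ succHgap) (fun P hP y => ?_) hx
  obtain ⟨z, hz⟩ := exists_first hP
  simp only [LinearMap.comp_apply, LinearEquiv.coe_coe]
  rw [isHalf_prec P hP, isHalf_succ P hP, isHalf_succ.rTensor_halfGen_mul hP, assoc_mul,
    succ_prec_gen hz, comulHgap_coassoc_apply, isHalf_prec.lTensor_halfGen_mul hP]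

theorem comul_succ_Hgap {x : Hgap K} (hx : x ∈ LinearMap.ker (counitHgap (K := K)).toLinearMap) :
    TensorProduct.assoc K _ _ _
        ((comulHgap (K := K)).toLinearMap.rTensor (Hgap K) (succHgap x))
      = (succHgap (K := K)).lTensor (Hgap K) (succHgap x) := by
  refine eq_of_mem_ker
    (f := (TensorProduct.assoc K _ _ _).toLinearMap ∘ₗ
      (comulHgap (K := K)).toLinearMap.rTensor (Hgap K) ∘ₗ succHgap)
    (g := (succHgap (K := K)).lTensor (Hgap K) ∘ₗ succHgap) (fun P hP y => ?_) hx
  obtain ⟨z, hz⟩ := exists_first hP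
  simp only [LinearMap.comp_apply, LinearEquiv.coe_coe]
  rw [isHalf_succ P hP, comul_rTensor_mul, assoc_mul, comul_succ_gen hz, comulHgap_coassoc_apply,
    isHalf_succ.lTensor_halfGen_mul hP]

theorem split_Hgap {x : Hgap K} (hx : x ∈ LinearMap.ker (counitHgap (K := K)).toLinearMap) :
    comulHgap x = precHgap x + succHgap x := by
  refine eq_of_mem_ker (f := (comulHgap (K := K)).toLinearMap) (g := precHgap + succHgap)
    (fun P hP y => ?_) hx
  obtain ⟨z, hz⟩ := exists_first hP
  rw [LinearMap.add_apply, isHalf_prec P hP, isHalf_succ P hP, ← add_mul, halfGen_add hz,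
    AlgHom.toLinearMap_apply, map_mul]

/-! ### Counits and leading terms -/

open Classical in
theorem counit_rTensor_halfGen (q : Prop → Prop) {P : NCP0} {z : Fin P.deg} (hz : z.val = 0) :
    Algebra.TensorProduct.map counitHgap (AlgHom.id K (Hgap K)) (halfGen (K := K) q P)
      = if q False then 1 ⊗ₜ[K] hgen P else 0 := by
  rw [halfGen_eq _ hz, map_sum, sum_cutsWith, Finset.sum_eq_single ∅]
  · refine if_congr (iff_of_eq (congrArg q (by simp))) ?_ rfl
    rw [Algebra.TensorProduct.map_tmul, gapProd_empty, hgen_restrict_empty rfl, map_one,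
      AlgHom.id_apply]
  · intro S _ hS
    rw [Algebra.TensorProduct.map_tmul, counitHgap_hgen_of_deg_ne_zero (P := P.restrict S)
      (Finset.card_ne_zero.2 (Finset.nonempty_iff_ne_empty.2 hS)), TensorProduct.zero_tmul,
      ite_self]
  · exact fun h => absurd (mem_cutSets.2 (IsCut.empty P)) h

open Classical in
theorem counit_lTensor_halfGen (q : Prop → Prop) {P : NCP0} {z : Fin P.deg} (hz : z.val = 0) :
    Algebra.TensorProduct.map (AlgHom.id K (Hgap K)) counitHgap (halfGen (K := K) q P)
      = if q True then hgen P ⊗ₜ[K] 1 else 0 := by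
  rw [halfGen_eq _ hz, map_sum, sum_cutsWith, Finset.sum_eq_single Finset.univ]
  · refine if_congr (iff_of_eq (congrArg q (by simp))) ?_ rfl
    rw [Algebra.TensorProduct.map_tmul, gapProd_univ, restrict_univ, map_one, AlgHom.id_apply]
  · intro S _ hS
    obtain ⟨y, hy⟩ : ∃ y, y ∉ S := by
      by_contra! h
      exact hS (Finset.eq_univ_of_forall h)
    rw [Algebra.TensorProduct.map_tmul, counitHgap_gapProd_of_mem hy, TensorProduct.tmul_zero,
      ite_self]
  · exact fun h => absurd (mem_cutSets.2 (IsCut.univ P)) h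

theorem isBialg_Hgap : IsBialg (comulHgap (K := K)).toLinearMap counitHgap.toLinearMap := by
  refine isBialg_of_algHom comulHgap_coassoc ?_ ?_
  · refine FreeAlgebra.hom_ext (funext fun P => ?_)
    obtain ⟨z, hz⟩ := exists_first P.2
    simp only [Function.comp_apply]
    rw [AlgHom.comp_apply, ← hgen_coe, ← halfGen_true hz, counit_rTensor_halfGen _ hz,
      if_pos trivial, Algebra.TensorProduct.includeRight_apply]
  · refine FreeAlgebra.hom_ext (funext fun P => ?_)
    obtain ⟨z, hz⟩ := exists_first P.2
    simp only [Function.comp_apply]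
    rw [AlgHom.comp_apply, ← hgen_coe, ← halfGen_true hz, counit_lTensor_halfGen _ hz,
      if_pos trivial, Algebra.TensorProduct.includeLeft_apply]

theorem counit_rTensor_comul (y : Hgap K) :
    Algebra.TensorProduct.map counitHgap (AlgHom.id K (Hgap K)) (comulHgap y) = 1 ⊗ₜ[K] y :=
  LinearMap.congr_fun isBialg_Hgap.counit_left y

theorem counit_lTensor_comul (y : Hgap K) :
    Algebra.TensorProduct.map (AlgHom.id K (Hgap K)) counitHgap (comulHgap y) = y ⊗ₜ[K] 1 :=
  LinearMap.congr_fun isBialg_Hgap.counit_right y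

/-- `H₊ ⊗ H₊` consists of the tensors killed by the counit on either side. -/
theorem mem_range_map_ker {A : Type*} [Ring A] [Algebra K A] (ε : A →ₐ[K] K) {u : A ⊗[K] A}
    (hr : Algebra.TensorProduct.map ε (AlgHom.id K A) u = 0)
    (hl : Algebra.TensorProduct.map (AlgHom.id K A) ε u = 0) :
    u ∈ LinearMap.range (TensorProduct.map (LinearMap.ker ε.toLinearMap).subtype
      (LinearMap.ker ε.toLinearMap).subtype) := by
  -- the projection onto the augmentation ideal along the scalars
  let π : A →ₗ[K] A := LinearMap.id - Algebra.linearMap K A ∘ₗ ε.toLinearMap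
  let π' : A →ₗ[K] LinearMap.ker ε.toLinearMap := π.codRestrict _ fun x => by
    simp [π]
  refine ⟨TensorProduct.map π' π' u, ?_⟩
  have h1 : TensorProduct.map (LinearMap.ker ε.toLinearMap).subtype
      (LinearMap.ker ε.toLinearMap).subtype (TensorProduct.map π' π' u)
      = TensorProduct.map π π u := by
    rw [← LinearMap.comp_apply, ← TensorProduct.map_comp]
    rfl
  have h2 : ∀ v : A ⊗[K] A, TensorProduct.map π π v = v
      - (Algebra.linearMap K A).rTensor A (Algebra.TensorProduct.map ε (AlgHom.id K A) v)
      - TensorProduct.map π (Algebra.linearMap K A)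
          (Algebra.TensorProduct.map (AlgHom.id K A) ε v) := by
    intro v
    induction v using TensorProduct.induction_on with
    | zero => simp
    | tmul a b =>
      simp [π, TensorProduct.sub_tmul, TensorProduct.tmul_sub]
    | add v w hv hw => simp only [map_add, hv, hw]; abel
  rw [h1, h2, hr, hl, map_zero, map_zero, sub_zero, sub_zero]

theorem prec_lead_Hgap {x : Hgap K} (hx : x ∈ LinearMap.ker (counitHgap (K := K)).toLinearMap) :
    precHgap x - x ⊗ₜ[K] 1 ∈ LinearMap.range
      (TensorProduct.map (LinearMap.ker (counitHgap (K := K)).toLinearMap).subtype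
        (LinearMap.ker (counitHgap (K := K)).toLinearMap).subtype) := by
  have hr : Algebra.TensorProduct.map counitHgap (AlgHom.id K (Hgap K)) (precHgap x) = 0 := by
    refine eq_of_mem_ker (f := (Algebra.TensorProduct.map counitHgap
      (AlgHom.id K (Hgap K))).toLinearMap ∘ₗ precHgap) (g := 0) (fun P hP y => ?_) hx
    obtain ⟨z, hz⟩ := exists_first hP
    rw [LinearMap.comp_apply, isHalf_prec P hP, AlgHom.toLinearMap_apply, map_mul,
      counit_rTensor_halfGen _ hz, if_neg id, zero_mul, LinearMap.zero_apply]
  have hl : Algebra.TensorProduct.map (AlgHom.id K (Hgap K)) counitHgap (precHgap x)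
      = x ⊗ₜ[K] (1 : K) := by
    refine eq_of_mem_ker (f := (Algebra.TensorProduct.map (AlgHom.id K (Hgap K))
      counitHgap).toLinearMap ∘ₗ precHgap) (g := (TensorProduct.mk K (Hgap K) K).flip 1)
      (fun P hP y => ?_) hx
    obtain ⟨z, hz⟩ := exists_first hP
    rw [LinearMap.comp_apply, isHalf_prec P hP, AlgHom.toLinearMap_apply, map_mul,
      counit_lTensor_halfGen _ hz, if_pos trivial, counit_lTensor_comul,
      Algebra.TensorProduct.tmul_mul_tmul, one_mul, LinearMap.flip_apply, TensorProduct.mk_apply]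
  refine mem_range_map_ker counitHgap ?_ ?_
  · rw [map_sub, hr, Algebra.TensorProduct.map_tmul, show counitHgap x = 0 from hx,
      TensorProduct.zero_tmul, sub_zero]
  · rw [map_sub, hl, Algebra.TensorProduct.map_tmul, map_one, AlgHom.id_apply, sub_self]

theorem succ_lead_Hgap {x : Hgap K} (hx : x ∈ LinearMap.ker (counitHgap (K := K)).toLinearMap) :
    succHgap x - 1 ⊗ₜ[K] x ∈ LinearMap.range
      (TensorProduct.map (LinearMap.ker (counitHgap (K := K)).toLinearMap).subtype
        (LinearMap.ker (counitHgap (K := K)).toLinearMap).subtype) := by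
  have hr : Algebra.TensorProduct.map counitHgap (AlgHom.id K (Hgap K)) (succHgap x)
      = (1 : K) ⊗ₜ[K] x := by
    refine eq_of_mem_ker (f := (Algebra.TensorProduct.map counitHgap
      (AlgHom.id K (Hgap K))).toLinearMap ∘ₗ succHgap) (g := TensorProduct.mk K K (Hgap K) 1)
      (fun P hP y => ?_) hx
    obtain ⟨z, hz⟩ := exists_first hP
    rw [LinearMap.comp_apply, isHalf_succ P hP, AlgHom.toLinearMap_apply, map_mul,
      counit_rTensor_halfGen _ hz, if_pos not_false, counit_rTensor_comul,
      Algebra.TensorProduct.tmul_mul_tmul, one_mul, TensorProduct.mk_apply]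
  have hl : Algebra.TensorProduct.map (AlgHom.id K (Hgap K)) counitHgap (succHgap x) = 0 := by
    refine eq_of_mem_ker (f := (Algebra.TensorProduct.map (AlgHom.id K (Hgap K))
      counitHgap).toLinearMap ∘ₗ succHgap) (g := 0) (fun P hP y => ?_) hx
    obtain ⟨z, hz⟩ := exists_first hP
    rw [LinearMap.comp_apply, isHalf_succ P hP, AlgHom.toLinearMap_apply, map_mul,
      counit_lTensor_halfGen _ hz, if_neg (not_not.2 trivial), zero_mul, LinearMap.zero_apply]
  refine mem_range_map_ker counitHgap ?_ ?_
  · rw [map_sub, hr, Algebra.TensorProduct.map_tmul, map_one, AlgHom.id_apply, sub_self]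
  · rw [map_sub, hl, Algebra.TensorProduct.map_tmul, show counitHgap x = 0 from hx,
      TensorProduct.tmul_zero, sub_zero]

end Codendriform

/-! ### Tensor products of coactions -/

section TensorCoaction

variable {K A B : Type*} [Field K] [Ring A] [Algebra K A] [CommRing B] [Algebra K B]

/-- `a ⊗ b ↦ (a ⊗ 1) ⊗ b`. -/
def inclLeft : A ⊗[K] B →ₐ[K] (A ⊗[K] A) ⊗[K] B :=
  Algebra.TensorProduct.map Algebra.TensorProduct.includeLeft (AlgHom.id K B)

/-- `a ⊗ b ↦ (1 ⊗ a) ⊗ b`. -/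
def inclRight : A ⊗[K] B →ₐ[K] (A ⊗[K] A) ⊗[K] B :=
  Algebra.TensorProduct.map Algebra.TensorProduct.includeRight (AlgHom.id K B)

@[simp]
theorem inclLeft_tmul (a : A) (b : B) :
    inclLeft (K := K) (a ⊗ₜ[K] b) = (a ⊗ₜ[K] 1) ⊗ₜ[K] b := rfl

@[simp]
theorem inclRight_tmul (a : A) (b : B) :
    inclRight (K := K) (a ⊗ₜ[K] b) = (1 ⊗ₜ[K] a) ⊗ₜ[K] b := rfl

/-- The tensor product of coactions, as a product in the algebra `(A ⊗ A) ⊗ B`. -/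
theorem merge_tmul (u v : A ⊗[K] B) :
    (LinearMap.mul' K B).lTensor (A ⊗[K] A) (TensorProduct.tensorTensorTensorComm K A B A B
      (u ⊗ₜ[K] v)) = inclLeft u * inclRight v := by
  induction u using TensorProduct.induction_on with
  | zero => simp
  | add u u' hu hu' => rw [TensorProduct.add_tmul, map_add, map_add, hu, hu', map_add, add_mul]
  | tmul a b =>
    induction v using TensorProduct.induction_on with
    | zero => simp
    | add v v' hv hv' => rw [TensorProduct.tmul_add, map_add, map_add, hv, hv', map_add, mul_add]
    | tmul c d => simp

theorem tensorCoaction_tmul (ρ : A →ₗ[K] A ⊗[K] B) (a b : A) :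
    tensorCoaction ρ ρ (a ⊗ₜ[K] b) = inclLeft (ρ a) * inclRight (ρ b) :=
  merge_tmul (ρ a) (ρ b)

/-- This is where the commutativity of `B` enters. -/
theorem inclRight_commute_inclLeft (v u : A ⊗[K] B) :
    Commute (inclRight v) (inclLeft u) := by
  refine Eq.symm ?_
  induction u using TensorProduct.induction_on with
  | zero => simp
  | add u u' hu hu' => rw [map_add, add_mul, mul_add, hu, hu']
  | tmul a b =>
    induction v using TensorProduct.induction_on with
    | zero => simp
    | add v v' hv hv' => rw [map_add, add_mul, mul_add, hv, hv']
    | tmul c d => simp [mul_comm]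

theorem tensorCoaction_mul (ρ : A →ₐ[K] A ⊗[K] B) (u v : A ⊗[K] A) :
    tensorCoaction ρ.toLinearMap ρ.toLinearMap (u * v)
      = tensorCoaction ρ.toLinearMap ρ.toLinearMap u
        * tensorCoaction ρ.toLinearMap ρ.toLinearMap v := by
  induction u using TensorProduct.induction_on with
  | zero => simp
  | add u u' hu hu' => rw [add_mul, map_add, map_add, hu, hu', add_mul]
  | tmul a b =>
    induction v using TensorProduct.induction_on with
    | zero => simp
    | add v v' hv hv' => rw [mul_add, map_add, map_add, hv, hv', mul_add]
    | tmul c d =>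
      rw [Algebra.TensorProduct.tmul_mul_tmul, tensorCoaction_tmul, tensorCoaction_tmul,
        tensorCoaction_tmul]
      simp only [AlgHom.toLinearMap_apply, map_mul]
      exact ((inclRight_commute_inclLeft (ρ b) (ρ c)).mul_mul_mul_comm _ _).symm

theorem isComoduleHom_unit (ρ : A →ₐ[K] A ⊗[K] B) :
    IsComoduleHom (unitCoaction K B) ρ.toLinearMap (Algebra.linearMap K A) := by
  refine LinearMap.ext_ring ?_
  simp only [LinearMap.comp_apply, unitCoaction, LinearMap.flip_apply, TensorProduct.mk_apply,
    LinearMap.rTensor_tmul, Algebra.linearMap_apply, map_one, AlgHom.toLinearMap_apply]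
  rfl

theorem isComoduleHom_mul (ρ : A →ₐ[K] A ⊗[K] B) :
    IsComoduleHom (tensorCoaction ρ.toLinearMap ρ.toLinearMap) ρ.toLinearMap
      (LinearMap.mul' K A) := by
  have key : ∀ u v : A ⊗[K] B,
      (LinearMap.mul' K A).rTensor B (inclLeft u * inclRight v) = u * v := by
    intro u v
    induction u using TensorProduct.induction_on with
    | zero => simp
    | add u u' hu hu' => rw [map_add, add_mul, map_add, hu, hu', add_mul]
    | tmul a b =>
      induction v using TensorProduct.induction_on with
      | zero => simp
      | add v v' hv hv' => rw [map_add, mul_add, map_add, hv, hv', mul_add]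
      | tmul c d => simp
  refine TensorProduct.ext' fun a b => ?_
  rw [LinearMap.comp_apply, tensorCoaction_tmul, key, LinearMap.comp_apply, LinearMap.mul'_apply]
  exact (map_mul ρ a b).symm

theorem range_rTensor_ker (ε : A →ₐ[K] K) {u : A ⊗[K] B}
    (hu : ε.toLinearMap.rTensor B u = 0) :
    u ∈ LinearMap.range ((LinearMap.ker ε.toLinearMap).subtype.rTensor B) := by
  have hex : Function.Exact (LinearMap.ker ε.toLinearMap).subtype ε.toLinearMap :=
    LinearMap.exact_subtype_ker_map _
  have hsurj : Function.Surjective ε.toLinearMap := fun k => ⟨algebraMap K A k, by simp⟩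
  exact (rTensor_exact B hex hsurj u).1 hu

/-- The antipode is a comodule morphism: `(S ⊗ Id) ρ` and `ρ S` are both convolution inverses
of `ρ`. -/
theorem isComoduleHom_antipode {Δ : A →ₗ[K] A ⊗[K] A} {ε : A →ₗ[K] K} (hΔ : IsCoalg Δ ε)
    (ρ : A →ₐ[K] A ⊗[K] B)
    (hε : IsComoduleHom ρ.toLinearMap (unitCoaction K B) ε)
    (hρ : IsComoduleHom ρ.toLinearMap (tensorCoaction ρ.toLinearMap ρ.toLinearMap) Δ)
    {S : A →ₗ[K] A} (hS : IsAntipode Δ ε S) :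
    IsComoduleHom ρ.toLinearMap ρ.toLinearMap S := by
  let _ : Coalgebra K A :=
    { comul := Δ
      counit := ε
      coassoc := hΔ.coassoc
      rTensor_counit_comp_comul := hΔ.counit_left
      lTensor_counit_comp_comul := hΔ.counit_right }
  let l : WithConv (A →ₗ[K] A ⊗[K] B) := WithConv.toConv (S.rTensor B ∘ₗ ρ.toLinearMap)
  let m : WithConv (A →ₗ[K] A ⊗[K] B) := WithConv.toConv ρ.toLinearMap
  let r : WithConv (A →ₗ[K] A ⊗[K] B) := WithConv.toConv (ρ.toLinearMap ∘ₗ S)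
  have hl : l * m = 1 := by
    have key : ∀ u v : A ⊗[K] B, S.rTensor B u * v
        = (LinearMap.mul' K A ∘ₗ S.rTensor A).rTensor B (inclLeft u * inclRight v) := by
      intro u v
      induction u using TensorProduct.induction_on with
      | zero => simp
      | add u u' hu hu' => rw [map_add, add_mul, map_add, add_mul, map_add, hu, hu']
      | tmul a b =>
        induction v using TensorProduct.induction_on with
        | zero => simp
        | add v v' hv hv' => rw [map_add, mul_add, mul_add, map_add, hv, hv']
        | tmul c d => simp
    have key' : ∀ w : A ⊗[K] A, LinearMap.mul' K (A ⊗[K] B)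
        (TensorProduct.map (S.rTensor B ∘ₗ ρ.toLinearMap) ρ.toLinearMap w)
        = (LinearMap.mul' K A ∘ₗ S.rTensor A).rTensor B
          (tensorCoaction ρ.toLinearMap ρ.toLinearMap w) := by
      intro w
      induction w using TensorProduct.induction_on with
      | zero => simp
      | add w w' hw hw' => simp only [map_add, hw, hw']
      | tmul a b =>
        rw [TensorProduct.map_tmul, LinearMap.mul'_apply, tensorCoaction_tmul, ← key]
        rfl
    refine WithConv.ofConv_injective (LinearMap.ext fun x => ?_)
    refine (key' (Δ x)).trans ?_
    have h1 : tensorCoaction ρ.toLinearMap ρ.toLinearMap (Δ x)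
        = Δ.rTensor B (ρ x) := (LinearMap.congr_fun hρ x).symm
    have h2 : ε.rTensor B (ρ x) = unitCoaction K B (ε x) := LinearMap.congr_fun hε x
    rw [h1, ← LinearMap.comp_apply, ← LinearMap.rTensor_comp, LinearMap.comp_assoc, hS.left,
      LinearMap.rTensor_comp, LinearMap.comp_apply, h2]
    exact LinearMap.congr_fun (isComoduleHom_unit ρ) (ε x) |>.trans (by
      simp [LinearMap.convOne_def, Algebra.linearMap_apply]
      rfl)
  have hr : m * r = 1 := by
    have key : ∀ w : A ⊗[K] A, LinearMap.mul' K (A ⊗[K] B)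
        (TensorProduct.map ρ.toLinearMap (ρ.toLinearMap ∘ₗ S) w)
        = ρ ((LinearMap.mul' K A) (S.lTensor A w)) := by
      intro w
      induction w using TensorProduct.induction_on with
      | zero => simp
      | add w w' hw hw' => simp only [map_add, hw, hw']
      | tmul a b => simp
    refine WithConv.ofConv_injective (LinearMap.ext fun x => ?_)
    refine (key (Δ x)).trans ?_
    have h : LinearMap.mul' K A (S.lTensor A (Δ x)) = algebraMap K A (ε x) :=
      LinearMap.congr_fun hS.right x
    rw [h, AlgHom.commutes]
    rfl
  exact congrArg WithConv.ofConv (left_inv_eq_right_inv hl hr)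

end TensorCoaction

/-! ### Compatibility of cuts and coarsenings -/

section CutsAndCoarsenings

variable {K : Type*} [Field K]

open Classical in
/-- The coarsenings of `P` for which `S` is still a cut. -/
def coarseningsCut (P : NCP0) (S : Finset (Fin P.deg)) : Finset (NCOf P.deg) :=
  P.coarsenings.filter fun Q => (NCP0.mk P.deg Q).IsCut S

theorem mem_coarseningsCut {P : NCP0} {S : Finset (Fin P.deg)} {Q : NCOf P.deg} :
    Q ∈ coarseningsCut P S ↔ Q ∈ P.coarsenings ∧ (NCP0.mk P.deg Q).IsCut S := by
  simp [coarseningsCut]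

/-- A coarsening of `P` for which `S` is a cut amounts to coarsenings of the restrictions of `P`
to `S` and to its gaps. -/
theorem tensorCoaction_cut {P : NCP0} {S : Finset (Fin P.deg)} (hS : P.IsCut S) :
    tensorCoaction (coactHgap (K := K)).toLinearMap coactHgap.toLinearMap
        (hgen (P.restrict S) ⊗ₜ[K] gapProd P S)
      = ∑ Q ∈ coarseningsCut P S, (hgen ((NCP0.mk P.deg Q).restrict S) ⊗ₜ[K]
          gapProd (NCP0.mk P.deg Q) S) ⊗ₜ[K] fibre (K := K) P Q := by
  classical
  -- the lower part goes to the left tensor factor, the gaps go to the right one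
  let lab : Fin (S.card + 2) → NCP0 → Hgap K ⊗[K] Hgap K :=
    Fin.cons (fun R => hgen R ⊗ₜ[K] 1) fun _ R => 1 ⊗ₜ[K] hgen R
  have hlab : ∀ P' : NCOf P.deg,
      (List.ofFn fun i => lab i ((NCP0.mk P.deg P').restrict (cutParts S i))).prod
        = hgen ((NCP0.mk P.deg P').restrict S) ⊗ₜ[K] gapProd (NCP0.mk P.deg P') S := by
    intro P'
    rw [List.ofFn_succ, List.prod_cons, gapProd_eq_ofFn]
    have h : ∀ {m : ℕ} (g : Fin m → Hgap K), (List.ofFn fun i => (1 : Hgap K) ⊗ₜ[K] g i).prod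
        = 1 ⊗ₜ[K] (List.ofFn g).prod := by
      intro m g
      rw [List.prod_ofFn_tmul, List.ofFn_const, List.prod_replicate, one_pow]
    refine (congrArg _ (h _)).trans ?_
    refine (Algebra.TensorProduct.tmul_mul_tmul _ _ _ _).trans ?_
    rw [mul_one, one_mul]
    rfl
  have hsum : tensorCoaction (coactHgap (K := K)).toLinearMap coactHgap.toLinearMap
        (hgen (P.restrict S) ⊗ₜ[K] gapProd P S)
      = (List.ofFn fun i => ∑ Q ∈ (P.restrict (cutParts S i)).coarsenings,
          lab i (NCP0.mk _ Q) ⊗ₜ[K] fibre (K := K) (P.restrict (cutParts S i)) Q).prod := by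
    rw [tensorCoaction_tmul, List.ofFn_succ, List.prod_cons, gapProd_eq_ofFn]
    simp only [AlgHom.toLinearMap_apply]
    rw [map_list_prod, map_list_prod, List.map_ofFn, List.map_ofFn, coactHgap_hgen, map_sum]
    congr 3
    funext i
    simp only [Function.comp_apply]
    rw [coactHgap_hgen, map_sum]
    rfl
  rw [hsum]
  refine (List.prod_ofFn_sum K _ fun i Q => lab i (NCP0.mk _ Q) ⊗ₜ[K]
    fibre (K := K) (P.restrict (cutParts S i)) Q).trans ?_
  refine (sum_piFinset_coarsenings (M := (Hgap K ⊗[K] Hgap K) ⊗[K] Bbl K) (cutPart S)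
    (cutParts S) mem_cutParts cutPart_noncrossing (isCut_iff.1 hS) _).trans ?_
  refine Finset.sum_congr ?_ fun Q hQ => ?_
  · ext Q
    rw [mem_coarseningsCut, Finset.mem_filter, isCut_iff]
  · have hQ' := isCut_iff.1 (mem_coarseningsCut.1 hQ).2
    rw [List.prod_ofFn_tmul, ← hlab Q, ← fibre_eq_prod (cutPart S) (cutParts S) mem_cutParts hQ',
      List.prod_ofFn]
    rfl

/-- The sums over cuts and over coarsenings are exchanged: a cut of a coarsening of `P` is a cut of
`P`. -/
theorem tensorCoaction_halfGen (q : Prop → Prop) {P : NCP0} {z : Fin P.deg} (hz : z.val = 0) :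
    tensorCoaction (coactHgap (K := K)).toLinearMap coactHgap.toLinearMap (halfGen q P)
      = ∑ Q ∈ P.coarsenings, halfGen q (NCP0.mk P.deg Q) ⊗ₜ[K] fibre P Q := by
  have h1 : ∀ Q : NCOf P.deg, halfGen (K := K) q (NCP0.mk P.deg Q) ⊗ₜ[K] fibre (K := K) P Q
      = ∑ S ∈ (NCP0.mk P.deg Q).cutsWith fun S => q (z ∈ S),
        (hgen (K := K) ((NCP0.mk P.deg Q).restrict S) ⊗ₜ[K]
          gapProd (K := K) (NCP0.mk P.deg Q) S) ⊗ₜ[K] fibre (K := K) P Q := by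
    intro Q
    rw [halfGen_eq (P := NCP0.mk P.deg Q) q hz, TensorProduct.sum_tmul]
  rw [Finset.sum_congr rfl fun Q _ => h1 Q, halfGen_eq _ hz, map_sum,
    Finset.sum_congr rfl fun S hS => tensorCoaction_cut (mem_cutSets.1 (mem_cutsWith.1 hS).1)]
  refine Finset.sum_comm' (s := P.cutsWith fun S => q (z ∈ S)) (t := coarseningsCut P)
    (t' := P.coarsenings) (s' := fun Q => (NCP0.mk P.deg Q).cutsWith fun S => q (z ∈ S)) ?_
  intro S Q
  rw [mem_cutsWith, mem_cutsWith, mem_cutSets, mem_cutSets, mem_coarseningsCut]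
  constructor
  · rintro ⟨⟨-, hq⟩, hQ, hS⟩
    exact ⟨⟨hS, hq⟩, hQ⟩
  · rintro ⟨⟨hS, hq⟩, hQ⟩
    exact ⟨⟨fun a b y hab => hS a b y (mem_coarsenings.1 hQ a b hab), hq⟩, hQ, hS⟩

theorem comul_coact_gen {P : NCP0} (hP : P.deg ≠ 0) :
    (comulHgap (K := K)).toLinearMap.rTensor (Bbl K) (coactHgap (K := K) (hgen P))
      = tensorCoaction (coactHgap (K := K)).toLinearMap coactHgap.toLinearMap
        (comulHgap (hgen P)) := by
  obtain ⟨z, hz⟩ := exists_first hP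
  rw [← halfGen_true hz, tensorCoaction_halfGen _ hz, coactHgap_hgen, map_sum]
  refine Finset.sum_congr rfl fun Q _ => ?_
  rw [LinearMap.rTensor_tmul, halfGen_true (P := NCP0.mk P.deg Q) hz, AlgHom.toLinearMap_apply]

theorem isComoduleHom_comulHgap : IsComoduleHom (coactHgap (K := K)).toLinearMap
    (tensorCoaction (coactHgap (K := K)).toLinearMap coactHgap.toLinearMap)
    (comulHgap (K := K)).toLinearMap := by
  refine LinearMap.ext fun x => ?_
  simp only [LinearMap.comp_apply, AlgHom.toLinearMap_apply]
  induction x using FreeAlgebra.induction with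
  | grade0 r =>
    simp only [Algebra.algebraMap_eq_smul_one, map_smul, map_one]
    congr 1
    rw [Algebra.TensorProduct.one_def, LinearMap.rTensor_tmul, Algebra.TensorProduct.one_def,
      tensorCoaction_tmul]
    simp only [AlgHom.toLinearMap_apply, map_one]
    rw [mul_one]
    rfl
  | grade1 P =>
    rw [← hgen_coe]
    exact comul_coact_gen (K := K) P.2
  | mul a b ha hb =>
    rw [map_mul (coactHgap (K := K)), map_mul (comulHgap (K := K)), comul_rTensor_mul,
      tensorCoaction_mul, ha, hb]
  | add a b ha hb => simp only [map_add, ha, hb]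

theorem IsHalf.coact {q : Prop → Prop} {D : Hgap K →ₗ[K] Hgap K ⊗[K] Hgap K} (hD : IsHalf q D)
    {x : Hgap K} (hx : x ∈ LinearMap.ker (counitHgap (K := K)).toLinearMap) :
    D.rTensor (Bbl K) (coactHgap (K := K) x)
      = tensorCoaction (coactHgap (K := K)).toLinearMap coactHgap.toLinearMap (D x) := by
  refine eq_of_mem_ker (f := D.rTensor (Bbl K) ∘ₗ (coactHgap (K := K)).toLinearMap)
    (g := tensorCoaction (coactHgap (K := K)).toLinearMap coactHgap.toLinearMap ∘ₗ D)
    (fun P hP y => ?_) hx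
  obtain ⟨z, hz⟩ := exists_first hP
  simp only [LinearMap.comp_apply, AlgHom.toLinearMap_apply]
  rw [hD P hP, tensorCoaction_mul, tensorCoaction_halfGen _ hz, map_mul, coactHgap_hgen,
    rTensor_sum_tmul_mul D (comulHgap (K := K)).toLinearMap _ _ _
      fun Q _ => hD.mul (counitHgap_hgen_of_deg_ne_zero (P := NCP0.mk P.deg Q) hP), map_sum]
  have h := LinearMap.congr_fun (isComoduleHom_comulHgap (K := K)) y
  simp only [LinearMap.comp_apply, AlgHom.toLinearMap_apply] at h
  rw [h]
  congr 1
  refine Finset.sum_congr rfl fun Q _ => ?_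
  rw [LinearMap.rTensor_tmul, hD.hgen (P := NCP0.mk P.deg Q) hP]

theorem isComoduleHom_counitHgap : IsComoduleHom (coactHgap (K := K)).toLinearMap
    (unitCoaction K (Bbl K)) (counitHgap (K := K)).toLinearMap := by
  have h : (Algebra.TensorProduct.map counitHgap (AlgHom.id K (Bbl K))).comp (coactHgap (K := K))
      = Algebra.TensorProduct.includeLeft.comp counitHgap := by
    refine FreeAlgebra.hom_ext (funext fun P => ?_)
    simp only [Function.comp_apply]
    rw [AlgHom.comp_apply, AlgHom.comp_apply, ← hgen_coe, coactHgap_hgen, map_sum,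
      counitHgap_hgen_of_deg_ne_zero P.2, map_zero]
    refine Finset.sum_eq_zero fun Q _ => ?_
    rw [Algebra.TensorProduct.map_tmul, counitHgap_hgen_of_deg_ne_zero (P := NCP0.mk P.1.deg Q) P.2,
      TensorProduct.zero_tmul]
  exact LinearMap.ext fun x => DFunLike.congr_fun h x

theorem coactHgap_mem_aug {x : Hgap K}
    (hx : x ∈ LinearMap.ker (counitHgap (K := K)).toLinearMap) :
    coactHgap (K := K) x ∈ LinearMap.range
      ((LinearMap.ker (counitHgap (K := K)).toLinearMap).subtype.rTensor (Bbl K)) := by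
  refine range_rTensor_ker counitHgap ?_
  have h := LinearMap.congr_fun (isComoduleHom_counitHgap (K := K)) x
  rw [LinearMap.comp_apply, LinearMap.comp_apply, LinearMap.mem_ker.1 hx, map_zero] at h
  exact h

end CutsAndCoarsenings

/-! ### The antipode -/

section ConvolutionInverse

variable {K A : Type*} [Field K] [Ring A] [Algebra K A]

/-- If `S` is a left convolution inverse of the identity, then `(Id * S) * Id = Id`. -/
theorem conv_conv_id {Δ : A →ₗ[K] A ⊗[K] A} {ε : A →ₗ[K] K} (hΔ : IsCoalg Δ ε)
    {S : A →ₗ[K] A} (hS : LinearMap.mul' K A ∘ₗ S.rTensor A ∘ₗ Δ = Algebra.linearMap K A ∘ₗ ε) :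
    LinearMap.mul' K A ∘ₗ (LinearMap.mul' K A ∘ₗ S.lTensor A ∘ₗ Δ).rTensor A ∘ₗ Δ
      = LinearMap.id := by
  let _ : Coalgebra K A :=
    { comul := Δ
      counit := ε
      coassoc := hΔ.coassoc
      rTensor_counit_comp_comul := hΔ.counit_left
      lTensor_counit_comp_comul := hΔ.counit_right }
  let i : WithConv (A →ₗ[K] A) := WithConv.toConv LinearMap.id
  let s : WithConv (A →ₗ[K] A) := WithConv.toConv S
  have h : s * i = 1 := WithConv.ofConv_injective hS
  have h' : i * s * i = i := by rw [mul_assoc, h, mul_one]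
  exact congrArg WithConv.ofConv h'

/-- The multiplicativity of the antipode axiom `∑ S(x₁) x₂ = ε(x)`, for an antimorphism `S`. -/
theorem mul_rTensor_mul {S : A →ₗ[K] A} (hS : ∀ a b, S (a * b) = S b * S a) {u : A ⊗[K] A} {k : K}
    (hu : LinearMap.mul' K A (S.rTensor A u) = algebraMap K A k) (v : A ⊗[K] A) :
    LinearMap.mul' K A (S.rTensor A (u * v)) = k • LinearMap.mul' K A (S.rTensor A v) := by
  induction v using TensorProduct.induction_on with
  | zero => simp
  | add v v' hv hv' => rw [mul_add, map_add, map_add, hv, hv', map_add, map_add, smul_add]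
  | tmul c d =>
    have h : ∀ u : A ⊗[K] A, LinearMap.mul' K A (S.rTensor A (u * c ⊗ₜ[K] d))
        = S c * LinearMap.mul' K A (S.rTensor A u) * d := by
      intro u
      induction u using TensorProduct.induction_on with
      | zero => simp
      | add u u' hu hu' =>
        rw [add_mul, map_add, map_add, hu, hu', map_add, map_add, mul_add, add_mul]
      | tmul a b => simp [hS, mul_assoc]
    rw [h, hu, ← Algebra.commutes, mul_assoc, ← Algebra.smul_def]
    rfl

/-- The multiplicativity of the antipode axiom `∑ x₁ S(x₂) = ε(x)`, for an antimorphism `S`. -/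
theorem mul_lTensor_mul {S : A →ₗ[K] A} (hS : ∀ a b, S (a * b) = S b * S a) {v : A ⊗[K] A} {k : K}
    (hv : LinearMap.mul' K A (S.lTensor A v) = algebraMap K A k) (u : A ⊗[K] A) :
    LinearMap.mul' K A (S.lTensor A (u * v)) = k • LinearMap.mul' K A (S.lTensor A u) := by
  induction u using TensorProduct.induction_on with
  | zero => simp
  | add u u' hu hu' => rw [add_mul, map_add, map_add, hu, hu', map_add, map_add, smul_add]
  | tmul a b =>
    have h : ∀ v : A ⊗[K] A, LinearMap.mul' K A (S.lTensor A (a ⊗ₜ[K] b * v))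
        = a * LinearMap.mul' K A (S.lTensor A v) * S b := by
      intro v
      induction v using TensorProduct.induction_on with
      | zero => simp
      | add v v' hv hv' =>
        rw [mul_add, map_add, map_add, hv, hv', map_add, map_add, mul_add, add_mul]
      | tmul c d => simp [hS, mul_assoc]
    rw [h, hv, ← Algebra.commutes, mul_assoc, ← Algebra.smul_def]
    rfl

end ConvolutionInverse

section Antipode

variable {K : Type*} [Field K]

theorem card_lt_of_mem_cutsWith_ne_univ {P : NCP0} {S : Finset (Fin P.deg)}
    (hS : S ∈ P.cutsWith fun S => S ≠ Finset.univ) : S.card < P.deg := by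
  obtain ⟨x, hx⟩ : ∃ x, x ∉ S := by
    by_contra! h
    exact (mem_cutsWith.1 hS).2 (Finset.eq_univ_of_forall h)
  simpa using Finset.card_lt_univ_of_notMem hx

/-- The antipode of a generator, by recursion on the degree: `S(P) = -∑ S(P|T) ∏ P|D_i` over the
cuts `T` whose upper part is not empty. -/
def antipodeGen (P : NCP0) : Hgap K :=
  if P.deg = 0 then 1 else
    -∑ S ∈ (P.cutsWith fun S => S ≠ Finset.univ).attach,
      antipodeGen (P.restrict S.1) * gapProd P S.1
termination_by P.deg
decreasing_by exact card_lt_of_mem_cutsWith_ne_univ S.2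

/-- The antipode of `H_gap^NC`, the antimorphism of algebras extending `antipodeGen`. -/
def antipodeHgap : Hgap K →ₗ[K] Hgap K :=
  (MulOpposite.opLinearEquiv K).symm.toLinearMap ∘ₗ
    (FreeAlgebra.lift K fun P : NCP => MulOpposite.op (antipodeGen (K := K) P.1)).toLinearMap

theorem antipodeHgap_mul (a b : Hgap K) :
    antipodeHgap (a * b) = antipodeHgap b * antipodeHgap a := by
  simp [antipodeHgap]

theorem antipodeHgap_one : antipodeHgap (1 : Hgap K) = 1 := by
  simp [antipodeHgap]

theorem antipodeHgap_hgen (P : NCP0) : antipodeHgap (hgen (K := K) P) = antipodeGen P := by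
  by_cases hP : P.deg = 0
  · rw [hgen_of_deg_eq_zero hP, antipodeHgap_one, antipodeGen, if_pos hP]
  · obtain ⟨P, rfl⟩ : ∃ P' : NCP, P'.1 = P := ⟨⟨P, hP⟩, rfl⟩
    rw [hgen_coe]
    simp [antipodeHgap]

theorem antipodeHgap_left_gen {P : NCP0} (hP : P.deg ≠ 0) :
    LinearMap.mul' K (Hgap K) (antipodeHgap.rTensor (Hgap K) (comulHgap (hgen (K := K) P)))
      = 0 := by
  have huniv : P.cutsWith (fun S => ¬ S ≠ Finset.univ) = {Finset.univ} := by
    ext S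
    rw [mem_cutsWith, not_not, Finset.mem_singleton, mem_cutSets]
    exact ⟨fun h => h.2, fun h => ⟨h ▸ IsCut.univ P, h⟩⟩
  rw [comulHgap_hgen, map_sum, map_sum]
  simp only [LinearMap.rTensor_tmul, LinearMap.mul'_apply, antipodeHgap_hgen]
  rw [← sum_cutsWith_add_not (p := fun S => S ≠ Finset.univ), huniv, Finset.sum_singleton,
    gapProd_univ, mul_one, restrict_univ, antipodeGen, if_neg hP, ← Finset.sum_attach]
  exact add_neg_cancel _

theorem hgen_induction {p : Hgap K → Prop} (hone : ∀ r : K, p (algebraMap K _ r))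
    (hgen : ∀ P : NCP0, P.deg ≠ 0 → p (hgen P)) (hmul : ∀ a b, p a → p b → p (a * b))
    (hadd : ∀ a b, p a → p b → p (a + b)) (x : Hgap K) : p x := by
  induction x using FreeAlgebra.induction with
  | grade0 r => exact hone r
  | grade1 P => exact hgen_coe (K := K) P ▸ hgen P.1 P.2
  | mul a b ha hb => exact hmul a b ha hb
  | add a b ha hb => exact hadd a b ha hb

theorem comulHgap_algebraMap (r : K) :
    comulHgap (algebraMap K (Hgap K) r) = r • ((1 : Hgap K) ⊗ₜ[K] (1 : Hgap K)) := by
  rw [AlgHom.commutes, Algebra.algebraMap_eq_smul_one, Algebra.TensorProduct.one_def]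

theorem antipodeHgap_left (x : Hgap K) :
    LinearMap.mul' K (Hgap K) (antipodeHgap.rTensor (Hgap K) (comulHgap x))
      = algebraMap K _ (counitHgap x) := by
  induction x using hgen_induction with
  | hone r =>
    rw [comulHgap_algebraMap, map_smul, map_smul, LinearMap.rTensor_tmul, antipodeHgap_one,
      LinearMap.mul'_apply, mul_one, AlgHom.commutes, Algebra.algebraMap_eq_smul_one]
    rfl
  | hgen P hP => rw [antipodeHgap_left_gen hP, counitHgap_hgen_of_deg_ne_zero hP, map_zero]
  | hmul a b ha hb =>
    rw [map_mul comulHgap, mul_rTensor_mul antipodeHgap_mul ha, hb, map_mul counitHgap, map_mul,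
      Algebra.smul_def]
  | hadd a b ha hb => simp only [map_add, ha, hb]

/-- By `conv_conv_id` the map `Id * S` satisfies the recursion `∑ (Id * S)(P|T) ∏ P|D_i = P`, of
which `ε` is the only solution. -/
theorem antipodeHgap_right_gen (P : NCP0) (hP : P.deg ≠ 0) :
    LinearMap.mul' K (Hgap K) (antipodeHgap.lTensor (Hgap K) (comulHgap (hgen (K := K) P)))
      = 0 := by
  let f : Hgap K →ₗ[K] Hgap K :=
    LinearMap.mul' K (Hgap K) ∘ₗ antipodeHgap.lTensor (Hgap K) ∘ₗ comulHgap.toLinearMap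
  change f (hgen P) = 0
  induction hn : P.deg using Nat.strong_induction_on generalizing P with
  | _ n ih =>
  have h : LinearMap.mul' K (Hgap K) (f.rTensor (Hgap K) (comulHgap (hgen P))) = hgen P :=
    LinearMap.congr_fun (conv_conv_id (isBialg_Hgap (K := K)).toIsCoalg
      (LinearMap.ext antipodeHgap_left)) (hgen P)
  have hf1 : f 1 = 1 := by
    change LinearMap.mul' K (Hgap K) (antipodeHgap.lTensor (Hgap K) (comulHgap 1)) = 1
    rw [map_one, Algebra.TensorProduct.one_def, LinearMap.lTensor_tmul, antipodeHgap_one,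
      LinearMap.mul'_apply, mul_one]
  have hne : (∅ : Finset (Fin P.deg)) ≠ Finset.univ := by
    intro h
    have := congrArg Finset.card h
    simp at this
    exact hP this.symm
  have hsum : ∑ S ∈ P.cutSets, f (hgen (P.restrict S)) * gapProd P S = f (hgen P) + hgen P := by
    rw [← Finset.add_sum_erase P.cutSets _ (mem_cutSets.2 (IsCut.univ P)),
      Finset.sum_eq_single_of_mem (∅ : Finset (Fin P.deg))
        (Finset.mem_erase.2 ⟨hne, mem_cutSets.2 (IsCut.empty P)⟩)]
    · rw [restrict_univ, gapProd_univ, mul_one, hgen_restrict_empty rfl, hf1, one_mul,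
        gapProd_empty]
    · intro S hS hS0
      rw [ih S.card (hn ▸ card_lt_of_mem_cutsWith_ne_univ (mem_cutsWith.2
          ⟨(Finset.mem_erase.1 hS).2, (Finset.mem_erase.1 hS).1⟩)) (P.restrict S)
        (Finset.card_ne_zero.2 (Finset.nonempty_iff_ne_empty.2 hS0)) rfl, zero_mul]
  rw [comulHgap_hgen, map_sum, map_sum] at h
  simp only [LinearMap.rTensor_tmul, LinearMap.mul'_apply] at h
  exact add_eq_right.1 (hsum.symm.trans h)

theorem antipodeHgap_right (x : Hgap K) :
    LinearMap.mul' K (Hgap K) (antipodeHgap.lTensor (Hgap K) (comulHgap x))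
      = algebraMap K _ (counitHgap x) := by
  induction x using hgen_induction with
  | hone r =>
    rw [comulHgap_algebraMap, map_smul, map_smul, LinearMap.lTensor_tmul, antipodeHgap_one,
      LinearMap.mul'_apply, mul_one, AlgHom.commutes, Algebra.algebraMap_eq_smul_one]
    rfl
  | hgen P hP => rw [antipodeHgap_right_gen P hP, counitHgap_hgen_of_deg_ne_zero hP, map_zero]
  | hmul a b ha hb =>
    rw [map_mul comulHgap, mul_lTensor_mul antipodeHgap_mul hb, ha, map_mul counitHgap, map_mul,
      Algebra.smul_def]
    exact Algebra.commutes _ _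
  | hadd a b ha hb => simp only [map_add, ha, hb]

theorem isAntipode_antipodeHgap :
    IsAntipode (comulHgap (K := K)).toLinearMap counitHgap.toLinearMap antipodeHgap :=
  ⟨LinearMap.ext antipodeHgap_left, LinearMap.ext antipodeHgap_right⟩

end Antipode

/-! ### The quotient map -/

section Quotient

variable {K : Type*} [Field K]

theorem proj_ι (P : NCP0) : proj (FreeAlgebra.ι K P) = hgen P :=
  FreeAlgebra.lift_ι_apply _ _

/-- The section of `proj` that keeps the nonempty partitions. -/
def sect : Hgap K →ₐ[K] Bgap K := FreeAlgebra.lift K fun P => FreeAlgebra.ι K P.1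

theorem sect_hgen {P : NCP0} (hP : P.deg ≠ 0) : sect (hgen (K := K) P) = FreeAlgebra.ι K P := by
  obtain ⟨P, rfl⟩ : ∃ P' : NCP, P'.1 = P := ⟨⟨P, hP⟩, rfl⟩
  rw [hgen_coe]
  exact FreeAlgebra.lift_ι_apply _ _

theorem proj_sect (x : Hgap K) : proj (sect x) = x := by
  have h : (proj (K := K)).comp sect = AlgHom.id K _ := by
    refine FreeAlgebra.hom_ext (funext fun P => ?_)
    simp only [Function.comp_apply]
    rw [AlgHom.comp_apply, ← hgen_coe, sect_hgen P.2, proj_ι, AlgHom.id_apply]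
  exact DFunLike.congr_fun h x

/-- Modulo `∅ - 1`, each element `x` of `B_gap^NC` is congruent to `sect (proj x)`. -/
theorem ker_proj : TwoSidedIdeal.ker (proj (K := K))
    = TwoSidedIdeal.span {FreeAlgebra.ι K emptyNCP0 - 1} := by
  apply le_antisymm
  · have key : ∀ x : Bgap K,
        (TwoSidedIdeal.span {FreeAlgebra.ι K emptyNCP0 - 1}).ringCon (sect (proj x)) x := by
      intro x
      induction x using FreeAlgebra.induction with
      | grade0 r =>
        rw [AlgHom.commutes, AlgHom.commutes]
        exact RingCon.refl _ _
      | grade1 P =>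
        rw [proj_ι]
        by_cases hP : P.deg = 0
        · obtain rfl : P = emptyNCP0 := eq_of_deg_eq_zero hP rfl
          rw [hgen_of_deg_eq_zero hP, map_one]
          refine RingCon.symm _ ((TwoSidedIdeal.rel_iff _ _ _).2 ?_)
          exact TwoSidedIdeal.subset_span rfl
        · rw [sect_hgen hP]
          exact RingCon.refl _ _
      | mul a b ha hb =>
        rw [map_mul, map_mul]
        exact RingCon.mul _ ha hb
      | add a b ha hb =>
        rw [map_add, map_add]
        exact RingCon.add _ ha hb
    intro x hx
    have h := key x
    rw [(TwoSidedIdeal.mem_ker _).1 hx, map_zero] at h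
    exact (TwoSidedIdeal.mem_iff _ _).2 (RingCon.symm _ h)
  · refine TwoSidedIdeal.span_le.2 ?_
    rintro _ rfl
    refine (TwoSidedIdeal.mem_ker _).2 ?_
    rw [map_sub, proj_ι, hgen_of_deg_eq_zero rfl, map_one, sub_self]

theorem comulHgap_proj (x : Bgap K) : comulHgap (proj x)
    = TensorProduct.map proj.toLinearMap proj.toLinearMap (comulBgap x) := by
  have h : (comulHgap (K := K)).comp proj
      = (Algebra.TensorProduct.map proj proj).comp comulBgap := by
    refine FreeAlgebra.hom_ext (funext fun P => ?_)
    simp only [Function.comp_apply]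
    rw [AlgHom.comp_apply, AlgHom.comp_apply, proj_ι, comulHgap_hgen, comulBgap,
      FreeAlgebra.lift_ι_apply, map_sum,
      ← sum_cuts P fun S => hgen (K := K) (P.restrict S) ⊗ₜ[K] gapProd (K := K) P S]
    refine Finset.sum_congr rfl fun L _ => ?_
    rw [Algebra.TensorProduct.map_tmul, proj_ι, map_list_prod, List.map_map,
      ← redGapMonomial_eq, redGapMonomial]
    congr 3
    funext Q
    exact (proj_ι Q).symm
  exact DFunLike.congr_fun h x

theorem counitHgap_proj (x : Bgap K) : counitHgap (proj x) = counitBgap x := by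
  have h : (counitHgap (K := K)).comp proj = counitBgap := by
    refine FreeAlgebra.hom_ext (funext fun P => ?_)
    simp only [Function.comp_apply]
    rw [AlgHom.comp_apply, proj_ι, counitHgap_hgen, counitBgap, FreeAlgebra.lift_ι_apply]
  exact DFunLike.congr_fun h x

theorem coactHgap_proj (x : Bgap K) : coactHgap (K := K) (proj x)
    = proj.toLinearMap.rTensor (Bbl K) (coactBgap (K := K) x) := by
  have h : (coactHgap (K := K)).comp proj
      = (Algebra.TensorProduct.map proj (AlgHom.id K (Bbl K))).comp coactBgap := by
    refine FreeAlgebra.hom_ext (funext fun P => ?_)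
    simp only [Function.comp_apply]
    rw [AlgHom.comp_apply, AlgHom.comp_apply, proj_ι, coactHgap_hgen, coactBgap,
      FreeAlgebra.lift_ι_apply, map_sum]
    refine Finset.sum_congr rfl fun Q _ => ?_
    rw [Algebra.TensorProduct.map_tmul, proj_ι]
    rfl
  exact DFunLike.congr_fun h x

end Quotient

section Main

variable {K : Type*} [Field K]

theorem isUnshuffleHopf_Hgap : IsUnshuffleHopf (comulHgap (K := K)).toLinearMap
    counitHgap.toLinearMap precHgap succHgap where
  toIsBialg := isBialg_Hgap
  antipode := ⟨antipodeHgap, isAntipode_antipodeHgap⟩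
  split _ hx := split_Hgap hx
  prec_lead _ hx := prec_lead_Hgap hx
  succ_lead _ hx := succ_lead_Hgap hx
  prec_prec _ hx := prec_prec_Hgap hx
  succ_prec _ hx := succ_prec_Hgap hx
  comul_succ _ hx := comul_succ_Hgap hx
  prec_mul _ hx y _ := isHalf_prec.mul hx y
  succ_mul _ hx y _ := isHalf_succ.mul hx y

theorem isUnshuffleHopfInComod_Hgap :
    IsUnshuffleHopfInComod (comulBbl (K := K)).toLinearMap counitBbl.toLinearMap
      coactHgap.toLinearMap comulHgap.toLinearMap counitHgap.toLinearMap precHgap succHgap where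
  base := isBialg_Bbl
  unshuffle := isUnshuffleHopf_Hgap
  comodule := isRightComodule_Hgap
  one_hom := isComoduleHom_unit (A := Hgap K) (B := Bbl K) coactHgap
  mul_hom := isComoduleHom_mul (A := Hgap K) (B := Bbl K) coactHgap
  counit_hom := isComoduleHom_counitHgap
  comul_hom := isComoduleHom_comulHgap
  antipode_hom _ hS := isComoduleHom_antipode (A := Hgap K) (B := Bbl K) isBialg_Hgap.toIsCoalg
    coactHgap isComoduleHom_counitHgap isComoduleHom_comulHgap hS
  aug _ hx := coactHgap_mem_aug hx
  prec_hom _ hx := isHalf_prec.coact hx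
  succ_hom _ hx := isHalf_succ.coact hx

end Main

end

/-- `H_gap^NC` is the quotient of `B_gap^NC` by the ideal generated by `∅ - 1`, with the induced
coproduct and counit; the coaction of `B_bl^NC` on `B_gap^NC` descends to it; and it makes
`H_gap^NC` an unshuffle Hopf algebra in the category of right `B_bl^NC`-comodules. -/
theorem mainTheorem2 (K : Type*) [Field K] [CharZero K] :
    (Function.Surjective (proj (K := K)) ∧
      TwoSidedIdeal.ker (proj (K := K)) =
        TwoSidedIdeal.span {FreeAlgebra.ι K emptyNCP0 - 1} ∧
      (∀ x : Bgap K, comulHgap (proj x)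
        = TensorProduct.map proj.toLinearMap proj.toLinearMap (comulBgap x)) ∧
      (∀ x : Bgap K, counitHgap (proj x) = counitBgap x)) ∧
    (∀ x : Bgap K, coactHgap (K := K) (proj x) =
      proj.toLinearMap.rTensor (Bbl K) (coactBgap (K := K) x)) ∧
    IsUnshuffleHopfInComod (comulBbl (K := K)).toLinearMap counitBbl.toLinearMap
      coactHgap.toLinearMap comulHgap.toLinearMap counitHgap.toLinearMap precHgap succHgap := by
  exact ⟨⟨fun x => ⟨sect x, proj_sect x⟩, ker_proj, comulHgap_proj, counitHgap_proj⟩,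
    coactHgap_proj, isUnshuffleHopfInComod_Hgap⟩
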